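/- **Setting.** Let $\mathbf{Hqsh}$ be the quasi-shuffle Hopf algebra over $\mathbb R$: the linear span of the words with letters in $\{1,2,3,\dots\}$, with product determined by $\emptyset\cdot w=w\cdot\emptyset=w$ and $(au)\cdot(bv)=a(u\cdot bv)+b(au\cdot v)+(a+b)(u\cdot v)$, and with the deconcatenation coproduct; $*$ denotes convolution of linear maps from $\mathbf{Hqsh}$ to an algebra, $e$ its unit, and $\mathrm{rev}$ word reversal. Let $\iota$ be the linear form equal to $1$ on words of length $\le 1$ and to $0$ on longer words. Let $\mathbf{Hck}$ be the Connes–Kreimer algebra (span of the rooted non-planar forests with nodes decorated by positive integers, product = disjoint union), let $\|f\|$ be the sum of the decorations of a forest $f$, and let $\alpha:\mathbf{Hck}\to\mathbf{Hqsh}$ be the arborification morphism, i.e. the algebra morphism with $\alpha(B^+_a(f))=a\,\alpha(f)$, where $B_a^+$ grafts all the trees of $f$ on a new root decorated by $a$. A character $\phi:\mathbf{Hqsh}\to\mathbb C$ solves the *algebraic problem of averages* if $\phi^{*-1}*\psi=\iota$, where $\psi$ is given by $\psi^{*-1}=\overline\phi\circ\mathrm{rev}$. It solves the *analytic problem of averages*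 if moreover there are $c,d>0$ with $|\phi(\alpha(f))|\le c\,d^{\|f\|}$ for all forests $f$. **Data.** Let $A=\mathbf{Hsh}$ be the real shuffle algebra on the two letters $1,2$. Let $R:A\to A$ be the linear projector fixing the empty word and all words beginning with $1$ and killing all words beginning with $2$, and put $\tilde R=\mathrm{id}-R$. Let $\theta=\sigma$ be the linear map that exchanges the letters $1$ and $2$ in each word, let $\Theta(w)=1/\ell(w)!$ with $\ell(w)$ the length of $w$, let $\gamma=\eta+\sigma(\eta)$ with $\eta$ a fixed word of length $2$ (length $2$ is forced by $\Theta(\gamma)=1$), and let $v=\mathrm{id}_A$. Let $\varepsilon:A\to\mathbb R$ be the augmentation (coefficient of the empty word). Let $\mathcal I:\mathbf{Hqsh}\to A$ be $1$ on $\emptyset$, $\gamma^{\omega}$ on a one-letter word $\omega$ and $0$ on longer words; put $a=\mathcal I-e$ and $\mathcal R(f)=R\circ f$. Put $(\mathcal Ra)^{[0]}=(\mathcal Ra)^{\{0\}}=e$, $(\mathcal Ra)^{[n+1]}=\mathcal R((\mathcal Ra)^{[n]}*a)$, $(\mathcal Ra)^{\{n+1\}}=\mathcal R(a*(\mathcal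 Ra)^{\{n\}})$, and $F=\sum_n t^n(\mathcal Ra)^{[n]}$, $H=\sum_n(-1)^n(\mathcal Ra)^{\{n\}}$. **Theorem.** 1. $(A,R,\theta,\sigma,\Theta,\gamma,v)$ is a well-behaved Rota–Baxter algebra, in the following sense. - $\varepsilon$ is a unital algebra morphism with $\varepsilon(\gamma)=0$ and $\varepsilon\circ\tilde R=0$. - $R$ is an idempotent Rota–Baxter operator of weight $-1$: $R(x)R(y)=R(R(x)y+xR(y)-xy)$. - $\sigma(\gamma^nb)=\gamma^n\sigma(b)$ for all $b\in\operatorname{Im}\tilde R$ and $n\ge0$. - $\Theta$ is a unital algebra morphism and $\Theta(\gamma)=1$. - $\theta(\tilde R(x))\equiv R(\sigma(x))\bmod\ker\Theta$ for all $x\in\ker\varepsilon$. - $\sigma(\gamma)=\gamma$. - $R(\gamma^n\tilde R(\sigma(b)))=0$ for all $b\in\operatorname{Im}\tilde R$ and $n\ge0$. - $v$ is multiplicative and unital, and there is $k>0$ such that for every $m\ge 0$ and every homogeneous $b\in\operatorname{Im}R$ (all words occurring in $b$ have the same length) one has $|\Theta(b)|\le|\Theta(v(b))|$ and $|\Theta(v(R(\gamma^mb)))|\le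 k^m|\Theta(v(b))|$. These elements $b$ include all $(\mathcal Ra)^{\{n\}}(\alpha(f))$ and all $H(\alpha(f))$, for $n\ge0$ and $f$ a forest. 2. $(\mathcal Ra)^{[n]}$ vanishes on all words of length $<n$, so that $F_{|t=-1}:\mathbf{Hqsh}\to A$ is well defined, and $\phi=\Theta\circ F_{|t=-1}$ is a character of $\mathbf{Hqsh}$ which solves both the algebraic and the analytic problem of averages. -/

import Mathlib

open TensorProduct

namespace RBAverages

noncomputable section

/-! ## Words, shuffle and quasi-shuffle algebras -/

/-- A commutative, associative, partially defined contraction of two letters into one.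
`none` means that the contraction is zero. -/
class Contraction (Ω : Type) where
  br : Ω → Ω → Option Ω
  br_comm : ∀ a b, br a b = br b a
  br_assoc : ∀ a b d, (br a b).bind (fun e => br e d) = (br b d).bind (fun e => br a e)

/-- The real linear span of the words with letters in `Ω`. -/
def WordAlg (Ω : Type) [Contraction Ω] : Type := List Ω →₀ ℝ

namespace WordAlg

variable {Ω : Type} [Contraction Ω]

instance : AddCommGroup (WordAlg Ω) := inferInstanceAs (AddCommGroup (List Ω →₀ ℝ))
instance : Module ℝ (WordAlg Ω) := inferInstanceAs (Module ℝ (List Ω →₀ ℝ))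

/-- A word as a basis element. -/
def word (w : List Ω) : WordAlg Ω := Finsupp.single w (1 : ℝ)

/-- The coefficient of a word. -/
def coef (x : WordAlg Ω) (w : List Ω) : ℝ := (show List Ω →₀ ℝ from x) w

/-- Linear extension of a map defined on words. -/
def extend {M : Type} [AddCommGroup M] [Module ℝ M] (f : List Ω → M) : WordAlg Ω →ₗ[ℝ] M :=
  Finsupp.linearCombination ℝ f

@[simp] theorem extend_word {M : Type} [AddCommGroup M] [Module ℝ M] (f : List Ω → M)
    (w : List Ω) : extend f (word w) = f w := by
  have h := Finsupp.linearCombination_single ℝ (1 : ℝ) w (v := f)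
  rw [one_smul] at h
  exact h

theorem hom_ext {M : Type} [AddCommGroup M] [Module ℝ M] {f g : WordAlg Ω →ₗ[ℝ] M}
    (h : ∀ w, f (word w) = g (word w)) : f = g :=
  Finsupp.lhom_ext' (fun w => LinearMap.ext_ring (h w))

/-- Prepending a letter: `L_a (w) = a w`. -/
def prepend (a : Ω) : WordAlg Ω →ₗ[ℝ] WordAlg Ω := extend (fun w => word (a :: w))

@[simp] theorem prepend_word (a : Ω) (w : List Ω) :
    prepend a (word w) = word (a :: w) := extend_word _ _

/-- Prepending a contracted letter (zero if the contraction is zero). -/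
def prependOpt (o : Option Ω) : WordAlg Ω →ₗ[ℝ] WordAlg Ω := o.elim 0 prepend

/-- The product of two words:
`(a u) * (b v) = a (u * b v) + b (a u * v) + [a,b] (u * v)`, the empty word being the unit. -/
def wordMul : List Ω → List Ω → WordAlg Ω
  | [], v => word v
  | a :: u, [] => word (a :: u)
  | a :: u, b :: v =>
      prepend a (wordMul u (b :: v)) + prepend b (wordMul (a :: u) v)
        + prependOpt (Contraction.br a b) (wordMul u v)
termination_by u v => u.length + v.length

/-- The product, extended bilinearly. -/
def mulL : WordAlg Ω →ₗ[ℝ] WordAlg Ω →ₗ[ℝ] WordAlg Ω :=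
  extend (fun u => extend (fun v => wordMul u v))

instance : Mul (WordAlg Ω) := ⟨fun x y => mulL x y⟩
instance : One (WordAlg Ω) := ⟨word []⟩

theorem mul_def (x y : WordAlg Ω) : x * y = mulL x y := rfl
theorem one_def : (1 : WordAlg Ω) = word [] := rfl

@[simp] theorem word_mul_word (u v : List Ω) :
    (word u : WordAlg Ω) * word v = wordMul u v := by
  rw [mul_def, mulL, extend_word, extend_word]

theorem wordMul_nil_left (v : List Ω) : wordMul ([] : List Ω) v = word v := by
  simp [wordMul]

theorem wordMul_nil_right (u : List Ω) : wordMul u ([] : List Ω) = word u := by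
  cases u <;> simp [wordMul]

theorem wordMul_comm (u v : List Ω) : wordMul u v = wordMul v u := by
  match u, v with
  | [], v => rw [wordMul_nil_left, wordMul_nil_right]
  | a :: u, [] => rw [wordMul_nil_left, wordMul_nil_right]
  | a :: u, b :: v =>
    rw [wordMul, wordMul, wordMul_comm u (b :: v), wordMul_comm (a :: u) v, wordMul_comm u v,
      Contraction.br_comm a b]
    abel
termination_by u.length + v.length

theorem wordAlg_add_mul (x y z : WordAlg Ω) : (x + y) * z = x * z + y * z := by
  simp [mul_def]

theorem wordAlg_mul_add (x y z : WordAlg Ω) : x * (y + z) = x * y + x * z := by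
  simp [mul_def]

theorem induction_word {P : WordAlg Ω → Prop} (x : WordAlg Ω) (h0 : P 0)
    (hadd : ∀ x y, P x → P y → P (x + y)) (hs : ∀ (c : ℝ) w, P (c • word w)) : P x := by
  refine Finsupp.induction_linear (motive := P) x h0 hadd (fun w c => ?_)
  have := hs c w
  have e : (c • word w : WordAlg Ω) = Finsupp.single w c := by
    have := Finsupp.smul_single_one w c
    exact this
  rwa [e] at this

theorem prepend_mul_prepend (a b : Ω) (x y : WordAlg Ω) :
    prepend a x * prepend b y = prepend a (x * prepend b y) + prepend b (prepend a x * y)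
      + prependOpt (Contraction.br a b) (x * y) := by
  have h : (mulL.compl₁₂ (prepend a) (prepend b) : WordAlg Ω →ₗ[ℝ] WordAlg Ω →ₗ[ℝ] WordAlg Ω) =
      (mulL.compl₁₂ LinearMap.id (prepend b)).compr₂ (prepend a)
      + (mulL.compl₁₂ (prepend a) LinearMap.id).compr₂ (prepend b)
      + mulL.compr₂ (prependOpt (Contraction.br a b)) := by
    refine hom_ext fun u => hom_ext fun v => ?_
    simp only [LinearMap.compl₁₂_apply, LinearMap.add_apply, LinearMap.compr₂_apply,
      LinearMap.id_apply, ← mul_def, prepend_word, word_mul_word]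
    rw [wordMul]
  have := congrArg (fun f => f x y) h
  simpa [← mul_def] using this

theorem wordAlg_one_mul (x : WordAlg Ω) : 1 * x = x := by
  have h : (mulL (1 : WordAlg Ω)) = LinearMap.id := by
    refine hom_ext fun u => ?_
    rw [← mul_def, one_def, word_mul_word, wordMul_nil_left, LinearMap.id_apply]
  have := congrArg (fun f => f x) h
  simpa [← mul_def] using this

theorem wordAlg_mul_comm (x y : WordAlg Ω) : x * y = y * x := by
  have h : (mulL : WordAlg Ω →ₗ[ℝ] WordAlg Ω →ₗ[ℝ] WordAlg Ω) = mulL.flip := by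
    refine hom_ext fun u => hom_ext fun v => ?_
    rw [LinearMap.flip_apply, ← mul_def, ← mul_def, word_mul_word, word_mul_word, wordMul_comm]
  exact congrArg (fun f => f x y) h

theorem opt_opt (a b d : Ω) (x y : WordAlg Ω) (p : Option Ω)
    (hp : Contraction.br a b = p) :
    prependOpt p x * prepend d y = prependOpt p (x * prepend d y)
      + prepend d (prependOpt p x * y)
      + prependOpt (p.bind fun e => Contraction.br e d) (x * y) := by
  cases p with
  | none => simp [prependOpt, mul_def]
  | some e => simpa [prependOpt] using prepend_mul_prepend e d x y

theorem opt_opt' (a b d : Ω) (x y : WordAlg Ω) (p : Option Ω)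
    (hp : Contraction.br b d = p) :
    prepend a x * prependOpt p y = prepend a (x * prependOpt p y)
      + prependOpt p (prepend a x * y)
      + prependOpt (p.bind fun e => Contraction.br a e) (x * y) := by
  cases p with
  | none => simp [prependOpt, mul_def]
  | some e => simpa [prependOpt] using prepend_mul_prepend a e x y

theorem word_assoc : ∀ (n : ℕ) (u v w : List Ω), u.length + v.length + w.length = n →
    (word u * word v) * word w = word u * (word v * (word w : WordAlg Ω)) := by
  intro n
  induction n using Nat.strong_induction_on with
  | _ n ih =>
    intro u v w hn
    match u, v, w with
    | [], v, w => rw [← one_def, wordAlg_one_mul, wordAlg_one_mul]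
    | a :: u, [], w => rw [← one_def, wordAlg_one_mul, wordAlg_mul_comm _ 1, wordAlg_one_mul]
    | a :: u, b :: v, [] =>
      rw [← one_def, wordAlg_mul_comm _ 1, wordAlg_one_mul, wordAlg_mul_comm _ 1, wordAlg_one_mul]
    | a :: u, b :: v, d :: w =>
      simp only [List.length_cons] at hn
      have ih' := fun (p q r : List Ω) (h : p.length + q.length + r.length < n) =>
        ih _ h p q r rfl
      have e1 := ih' u (b :: v) (d :: w) (by grind)
      have e2 := ih' (a :: u) v (d :: w) (by grind)
      have e3 := ih' (a :: u) (b :: v) w (by grind)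
      have e4 := ih' u v (d :: w) (by grind)
      have e5 := ih' u (b :: v) w (by grind)
      have e6 := ih' (a :: u) v w (by grind)
      have e7 := ih' u v w (by grind)
      simp only [← prepend_word] at e1 e2 e3 e4 e5 e6 e7 ⊢
      generalize hx : (word u : WordAlg Ω) = x at *
      generalize hy : (word v : WordAlg Ω) = y at *
      generalize hz : (word w : WordAlg Ω) = z at *
      have l3 : prepend d ((prepend a x * prepend b y) * z)
          = prepend d (prepend a x * (prepend b y * z)) := by rw [e3]
      have r1 : prepend a ((x * prepend b y) * prepend d z)
          = prepend a (x * (prepend b y * prepend d z)) := by rw [e1]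
      rw [prepend_mul_prepend a b x y, wordAlg_add_mul, wordAlg_add_mul, map_add, map_add] at l3
      rw [prepend_mul_prepend b d y z, wordAlg_mul_add, wordAlg_mul_add, map_add, map_add] at r1
      rw [prepend_mul_prepend a b x y, prepend_mul_prepend b d y z, wordAlg_add_mul, wordAlg_add_mul, wordAlg_mul_add,
        wordAlg_mul_add, prepend_mul_prepend a d, prepend_mul_prepend b d, opt_opt a b d _ _ _ rfl,
        prepend_mul_prepend a b, prepend_mul_prepend a d, opt_opt' a b d _ _ _ rfl,
        Contraction.br_assoc a b d, ← l3, r1, e2, e4, e5, e6, e7]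
      abel

theorem wordAlg_mul_assoc (x y z : WordAlg Ω) : (x * y) * z = x * (y * z) := by
  induction x using induction_word with
  | h0 => simp [mul_def]
  | hadd x x' hx hx' => simp only [wordAlg_add_mul, hx, hx']
  | hs c u =>
    induction y using induction_word with
    | h0 => simp [mul_def]
    | hadd y y' hy hy' => simp only [wordAlg_add_mul, wordAlg_mul_add, hy, hy']
    | hs c' v =>
      induction z using induction_word with
      | h0 => simp [mul_def]
      | hadd z z' hz hz' => simp only [wordAlg_mul_add, hz, hz']
      | hs c'' w =>
        have h := word_assoc _ u v w rfl
        simp only [mul_def] at h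
        simp only [mul_def, map_smul, LinearMap.smul_apply, h]

instance : CommRing (WordAlg Ω) :=
  { (inferInstance : AddCommGroup (WordAlg Ω)), (inferInstance : Mul (WordAlg Ω)),
    (inferInstance : One (WordAlg Ω)) with
    mul_assoc := wordAlg_mul_assoc
    one_mul := wordAlg_one_mul
    mul_one := fun x => by rw [wordAlg_mul_comm, wordAlg_one_mul]
    left_distrib := wordAlg_mul_add
    right_distrib := wordAlg_add_mul
    zero_mul := fun x => by simp [mul_def]
    mul_zero := fun x => by simp [mul_def]
    mul_comm := wordAlg_mul_comm }

instance : Algebra ℝ (WordAlg Ω) :=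
  Algebra.ofModule (fun c x y => by simp [mul_def]) (fun c x y => by simp [mul_def])

/-! ### Deconcatenation -/

/-- The counit: coefficient of the empty word. -/
def counitL : WordAlg Ω →ₗ[ℝ] ℝ := extend (fun w => if w.isEmpty then 1 else 0)

/-- Deconcatenation: `Δ(w) = ∑_{w = w₁ w₂} w₁ ⊗ w₂`. -/
def comulL : WordAlg Ω →ₗ[ℝ] WordAlg Ω ⊗[ℝ] WordAlg Ω :=
  extend (fun w => ∑ i ∈ Finset.range (w.length + 1), word (w.take i) ⊗ₜ[ℝ] word (w.drop i))

theorem comulL_word_nil : comulL (word ([] : List Ω)) = word [] ⊗ₜ[ℝ] word [] := by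
  simp [comulL]

theorem comulL_word_cons (a : Ω) (w : List Ω) :
    comulL (word (a :: w)) = word [] ⊗ₜ[ℝ] word (a :: w)
      + (prepend a).rTensor (WordAlg Ω) (comulL (word w)) := by
  simp only [comulL, extend_word, List.length_cons]
  rw [Finset.sum_range_succ', add_comm, map_sum]
  simp

theorem counitL_comp_prepend (a : Ω) :
    (counitL : WordAlg Ω →ₗ[ℝ] ℝ) ∘ₗ prepend a = 0 :=
  hom_ext fun w => by simp [counitL]

theorem comul_prepend (a : Ω) (x : WordAlg Ω) :
    comulL (prepend a x) = word [] ⊗ₜ[ℝ] prepend a x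
      + (prepend a).rTensor (WordAlg Ω) (comulL x) := by
  have h : comulL ∘ₗ prepend a = (TensorProduct.mk ℝ _ _ (word [])) ∘ₗ prepend a
      + (prepend a).rTensor (WordAlg Ω) ∘ₗ comulL :=
    hom_ext fun w => by simp [comulL_word_cons]
  exact congrArg (fun f => f x) h

instance : Coalgebra ℝ (WordAlg Ω) where
  comul := comulL
  counit := counitL
  coassoc := by
    refine hom_ext fun w => ?_
    induction w with
    | nil => simp [comulL_word_nil]
    | cons a w ih =>
      simp only [LinearMap.comp_apply, LinearEquiv.coe_coe] at ih ⊢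
      have key : ∀ t : WordAlg Ω ⊗[ℝ] WordAlg Ω,
          (TensorProduct.assoc ℝ (WordAlg Ω) (WordAlg Ω) (WordAlg Ω))
            (comulL.rTensor (WordAlg Ω) ((prepend a).rTensor (WordAlg Ω) t))
          = word [] ⊗ₜ[ℝ] ((prepend a).rTensor (WordAlg Ω) t)
            + (prepend a).rTensor (WordAlg Ω ⊗[ℝ] WordAlg Ω)
              ((TensorProduct.assoc ℝ (WordAlg Ω) (WordAlg Ω) (WordAlg Ω))
                (comulL.rTensor (WordAlg Ω) t)) := by
        intro t
        induction t with
        | zero => simp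
        | add s t hs ht =>
          simp only [map_add, TensorProduct.tmul_add, hs, ht]
          abel
        | tmul x y =>
          simp only [LinearMap.rTensor_tmul, comul_prepend, TensorProduct.add_tmul, map_add,
            TensorProduct.assoc_tmul]
          congr 1
          generalize comulL x = s
          induction s with
          | zero => simp
          | add s t hs ht => simp only [map_add, TensorProduct.add_tmul, hs, ht]
          | tmul p q => simp
      have key2 : ∀ t : WordAlg Ω ⊗[ℝ] WordAlg Ω,
          comulL.lTensor (WordAlg Ω) ((prepend a).rTensor (WordAlg Ω) t)
          = (prepend a).rTensor (WordAlg Ω ⊗[ℝ] WordAlg Ω) (comulL.lTensor (WordAlg Ω) t) := by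
        intro t
        induction t with
        | zero => simp
        | add s t hs ht => simp only [map_add, hs, ht]
        | tmul x y => simp
      rw [comulL_word_cons, map_add, map_add, map_add, key, key2, ih, LinearMap.rTensor_tmul,
        LinearMap.lTensor_tmul, comulL_word_nil, TensorProduct.assoc_tmul, comulL_word_cons,
        TensorProduct.tmul_add]
      abel
  rTensor_counit_comp_comul := by
    refine hom_ext fun w => ?_
    cases w with
    | nil => simp [comulL_word_nil, counitL]
    | cons a w =>
      have h := LinearMap.rTensor_comp (WordAlg Ω) counitL (prepend a)
      rw [counitL_comp_prepend, LinearMap.rTensor_zero] at h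
      have h2 := congrArg (fun f => f (comulL (word w))) h
      simp only [LinearMap.comp_apply, LinearMap.zero_apply] at h2
      rw [LinearMap.comp_apply, comulL_word_cons, map_add, ← h2]
      simp [counitL]
  lTensor_counit_comp_comul := by
    refine hom_ext fun w => ?_
    induction w with
    | nil => simp [comulL_word_nil, counitL]
    | cons a w ih =>
      have key : ∀ t : WordAlg Ω ⊗[ℝ] WordAlg Ω,
          counitL.lTensor (WordAlg Ω) ((prepend a).rTensor (WordAlg Ω) t)
          = (prepend a).rTensor ℝ (counitL.lTensor (WordAlg Ω) t) := by
        intro t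
        induction t with
        | zero => simp
        | add s t hs ht => simp only [map_add, hs, ht]
        | tmul x y => simp
      rw [LinearMap.comp_apply] at ih
      rw [LinearMap.comp_apply, comulL_word_cons, map_add, key, ih]
      simp [counitL]

/-- Word reversal. -/
def rev : WordAlg Ω →ₗ[ℝ] WordAlg Ω := extend (fun w => word w.reverse)

/-- Linear combinations of words that all have the same length. -/
def IsHomogeneous (x : WordAlg Ω) : Prop :=
  ∃ l : ℕ, ∀ w : List Ω, coef x w ≠ 0 → w.length = l

end WordAlg

open WordAlg

/-- On the semigroup of positive integers the contraction of two letters is their sum. -/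
instance : Contraction ℕ+ where
  br a b := some (a + b)
  br_comm a b := by rw [add_comm]
  br_assoc a b d := by simp [add_assoc]

/-- The quasi-shuffle Hopf algebra on the letters `1, 2, 3, …`
(quasi-shuffle product, deconcatenation coproduct). -/
abbrev Hqsh : Type := WordAlg ℕ+

/-- The two letters `1` and `2` of the shuffle algebra. -/
inductive Letter : Type where
  | one : Letter
  | two : Letter

/-- The exchange of the letters `1` and `2`. -/
def Letter.bar : Letter → Letter
  | .one => .two
  | .two => .one

/-- No contraction: the product is the ordinary shuffle. -/
instance : Contraction Letter where
  br _ _ := none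
  br_comm _ _ := rfl
  br_assoc _ _ _ := rfl

/-- The shuffle algebra on the two letters `1, 2`. -/
abbrev Hsh : Type := WordAlg Letter

/-! ## Rooted forests and the Connes-Kreimer algebra -/

/-- Planar forests with nodes decorated by positive integers: `node a s r` is the forest whose
first tree has root `a` and subforest `s` above its root, followed by the forest `r`. -/
inductive PlanarForest : Type where
  | nil : PlanarForest
  | node : ℕ+ → PlanarForest → PlanarForest → PlanarForest

namespace PlanarForest

/-- Juxtaposition. -/
def append : PlanarForest → PlanarForest → PlanarForest
  | nil, g => g
  | node a s r, g => node a s (append r g)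

/-- Sum of all decorations. -/
def weight : PlanarForest → ℕ
  | nil => 0
  | node a s r => (a : ℕ) + weight s + weight r

/-- Two planar forests are the same (non-planar) forest: the equivalence relation generated by
exchanging neighbouring trees, at any level. -/
inductive Same : PlanarForest → PlanarForest → Prop where
  | refl (f) : Same f f
  | symm {f g} : Same f g → Same g f
  | trans {f g h} : Same f g → Same g h → Same f h
  | swap (a b s t r) : Same (node a s (node b t r)) (node b t (node a s r))
  | congr (a) {s s' r r'} : Same s s' → Same r r' → Same (node a s r) (node a s' r')

theorem append_nil (f : PlanarForest) : f.append nil = f := by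
  induction f with
  | nil => rfl
  | node a s r _ ih => rw [append, ih]

theorem append_assoc (f g h : PlanarForest) :
    (f.append g).append h = f.append (g.append h) := by
  induction f with
  | nil => rfl
  | node a s r _ ih => rw [append, append, append, ih]

theorem same_append_left (f : PlanarForest) {g g' : PlanarForest} (h : Same g g') :
    Same (f.append g) (f.append g') := by
  induction f with
  | nil => exact h
  | node a s r _ ih => exact .congr a (.refl s) ih

theorem same_append_right {f f' : PlanarForest} (h : Same f f') (g : PlanarForest) :
    Same (f.append g) (f'.append g) := by
  induction h with
  | refl f => exact .refl _
  | symm _ ih => exact .symm ih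
  | trans _ _ ih ih' => exact .trans ih ih'
  | swap a b s t r => exact .swap a b s t _
  | congr a hs _ _ ih' => exact .congr a hs ih'

theorem same_append_node (f : PlanarForest) (a : ℕ+) (s r : PlanarForest) :
    Same (f.append (node a s r)) (node a s (f.append r)) := by
  induction f with
  | nil => exact .refl _
  | node b t q _ ih => exact .trans (.congr b (.refl t) ih) (.swap b a t s _)

theorem same_append_comm (f g : PlanarForest) : Same (f.append g) (g.append f) := by
  induction f with
  | nil => rw [append_nil]; exact .refl _
  | node a s r _ ih =>
    exact .trans (.congr a (.refl s) ih) (.symm (same_append_node g a s r))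

theorem same_weight {f g : PlanarForest} (h : Same f g) : f.weight = g.weight := by
  induction h with
  | refl f => rfl
  | symm _ ih => exact ih.symm
  | trans _ _ ih ih' => exact ih.trans ih'
  | swap a b s t r => simp only [weight]; omega
  | congr a _ _ ih ih' => simp only [weight, ih, ih']

instance setoid : Setoid PlanarForest := ⟨Same, .refl, .symm, .trans⟩

end PlanarForest

/-- Rooted (non-planar) forests with nodes decorated by positive integers. -/
def Forest : Type := Quotient PlanarForest.setoid

namespace Forest

instance : CommMonoid Forest where
  mul := Quotient.map₂ PlanarForest.append fun _ _ h _ _ h' =>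
    .trans (PlanarForest.same_append_right h _) (PlanarForest.same_append_left _ h')
  one := Quotient.mk _ PlanarForest.nil
  mul_assoc := by
    rintro ⟨f⟩ ⟨g⟩ ⟨h⟩
    exact congrArg (Quotient.mk _) (PlanarForest.append_assoc f g h)
  one_mul := by
    rintro ⟨f⟩
    rfl
  mul_one := by
    rintro ⟨f⟩
    exact congrArg (Quotient.mk _) (PlanarForest.append_nil f)
  mul_comm := by
    rintro ⟨f⟩ ⟨g⟩
    exact Quotient.sound (PlanarForest.same_append_comm f g)

/-- Grafting all the trees of a forest on a new root `a`. -/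
def graft (a : ℕ+) : Forest → Forest :=
  Quotient.map (fun s => PlanarForest.node a s .nil) fun _ _ h => .congr a h (.refl _)

/-- Sum of the decorations of all nodes. -/
def weight : Forest → ℕ :=
  Quotient.lift PlanarForest.weight fun _ _ h => PlanarForest.same_weight h

end Forest

/-- The Connes-Kreimer algebra: linear span of the forests, with juxtaposition as product. -/
abbrev Hck : Type := MonoidAlgebra ℝ Forest

/-- A forest as a basis element. -/
def Hck.forest (f : Forest) : Hck := MonoidAlgebra.of ℝ Forest f

/-- The arborification of a planar forest: juxtaposition goes to the quasi-shuffle product and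
grafting on a root `a` goes to prepending the letter `a`. -/
def PlanarForest.arb : PlanarForest → Hqsh
  | .nil => 1
  | .node a s r => prepend a (arb s) * arb r

theorem PlanarForest.arb_append (f g : PlanarForest) :
    (f.append g).arb = f.arb * g.arb := by
  induction f with
  | nil => simp [PlanarForest.append, PlanarForest.arb]
  | node a s r _ ih => simp only [PlanarForest.append, PlanarForest.arb, ih, mul_assoc]

theorem PlanarForest.same_arb {f g : PlanarForest} (h : Same f g) : f.arb = g.arb := by
  induction h with
  | refl f => rfl
  | symm _ ih => exact ih.symm
  | trans _ _ ih ih' => exact ih.trans ih'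
  | swap a b s t r => simp only [PlanarForest.arb, mul_left_comm]
  | congr a _ _ ih ih' => simp only [PlanarForest.arb, ih, ih']

/-- Arborification of forests as a morphism of monoids. -/
def Forest.arb : Forest →* Hqsh where
  toFun := Quotient.lift PlanarForest.arb fun _ _ h => PlanarForest.same_arb h
  map_one' := rfl
  map_mul' := by
    rintro ⟨f⟩ ⟨g⟩
    exact PlanarForest.arb_append f g

/-- The arborification morphism `α : Hck → Hqsh`. -/
def arborification : Hck →ₐ[ℝ] Hqsh := MonoidAlgebra.lift ℝ Hqsh Forest Forest.arb

theorem arborification_forest (f : Forest) : arborification (Hck.forest f) = Forest.arb f :=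
  MonoidAlgebra.lift_of _ _

/-- The defining property `α ∘ B₊ = L ∘ α`. -/
theorem arborification_graft (a : ℕ+) (f : Forest) :
    arborification (Hck.forest (f.graft a)) = prepend a (arborification (Hck.forest f)) := by
  rw [arborification_forest, arborification_forest]
  induction f using Quotient.inductionOn with
  | h f => exact mul_one _

/-! ## Rota-Baxter algebras and the Atkinson recursion -/

section Atkinson

variable {A : Type} [CommRing A] [Algebra ℝ A]

/-- The Rota-Baxter relation of weight `c`. -/
def IsRotaBaxter (c : ℝ) (R : A →ₗ[ℝ] A) : Prop :=
  ∀ x y, R x * R y = R (R x * y + x * R y + c • (x * y))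

/-- The space of linear maps `Hqsh → A` with its convolution product. -/
abbrev Conv (A : Type) [CommRing A] [Algebra ℝ A] : Type := WithConv (Hqsh →ₗ[ℝ] A)

/-- The map `𝓘` with `𝓘(∅) = 1`, `𝓘(ω) = γ ^ ω` on one-letter words, and `0` on longer words. -/
def mapI (γ : A) : Conv A := WithConv.toConv <| extend fun w =>
  match w with
  | [] => 1
  | [n] => γ ^ (n : ℕ)
  | _ => 0

/-- `a = 𝓘 - e`, where `e` is the unit of the convolution product. -/
def mapa (γ : A) : Conv A := mapI γ - 1

/-- The Rota-Baxter operator `f ↦ R ∘ f`. -/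
def liftR (R : A →ₗ[ℝ] A) (f : Conv A) : Conv A := WithConv.toConv (R ∘ₗ f.ofConv)

/-- The iterates `(𝓡a)^[0] = e`, `(𝓡a)^[n+1] = 𝓡((𝓡a)^[n] * a)`. -/
def iterR (R : A →ₗ[ℝ] A) (a : Conv A) : ℕ → Conv A
  | 0 => 1
  | n + 1 => liftR R (iterR R a n * a)

/-- The iterates `(𝓡a)^{0} = e`, `(𝓡a)^{n+1} = 𝓡(a * (𝓡a)^{n})`. -/
def iterR' (R : A →ₗ[ℝ] A) (a : Conv A) : ℕ → Conv A
  | 0 => 1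
  | n + 1 => liftR R (a * iterR' R a n)

/-- The series `F = ∑ tⁿ (𝓡a)^[n]` solving `F = e + t 𝓡(F * a)`. -/
def seriesF (R : A →ₗ[ℝ] A) (γ : A) : PowerSeries (Conv A) :=
  PowerSeries.mk (iterR R (mapa γ))

/-- The series `∑ tⁿ (𝓡a)^{n}`. -/
def seriesH (R : A →ₗ[ℝ] A) (γ : A) : PowerSeries (Conv A) :=
  PowerSeries.mk (iterR' R (mapa γ))

/-- Evaluation of a series at `t = -1`. On a word `w` the sum is truncated after the term of
index `length w`; for the two series above all later terms vanish on `w`. -/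
def evalNegOne (S : PowerSeries (Conv A)) : Hqsh →ₗ[ℝ] A := extend fun w =>
  ∑ n ∈ Finset.range (w.length + 1), (-1 : ℝ) ^ n • (PowerSeries.coeff n S) (word w)

end Atkinson

/-! ## The problem of averages -/

/-- The linear form `ι`, equal to `1` on words of length at most one and to `0` on longer ones. -/
def iota : Conv ℂ := WithConv.toConv <| extend fun w => if w.length ≤ 1 then 1 else 0

/-- `φ` solves the algebraic problem of averages: `φ` and `ψ` being invertible for
convolution, `ψ⁻¹ = conj φ ∘ rev` and `φ⁻¹ * ψ = ι`. -/
def SolvesAlgebraicProblem (φ : Hqsh →ₐ[ℝ] ℂ) : Prop :=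
  ∃ u ψ : (Conv ℂ)ˣ,
    (u : Conv ℂ) = WithConv.toConv φ.toLinearMap ∧
    ((ψ⁻¹ : (Conv ℂ)ˣ) : Conv ℂ) =
      WithConv.toConv (Complex.conjAe.toLinearMap ∘ₗ φ.toLinearMap ∘ₗ rev) ∧
    ((u⁻¹ * ψ : (Conv ℂ)ˣ) : Conv ℂ) = iota

/-- Geometrical growth of a character of the Connes-Kreimer algebra. -/
def HasGeometricGrowth (κ : Hck →ₐ[ℝ] ℂ) : Prop :=
  ∃ a b : ℝ, 0 < a ∧ 0 < b ∧ ∀ f : Forest, ‖κ (Hck.forest f)‖ ≤ a * b ^ f.weight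

/-- `φ` solves the algebraic problem of averages and its contracted arborification `φ ∘ α` has
geometrical growth. -/
def SolvesAnalyticProblem (φ : Hqsh →ₐ[ℝ] ℂ) : Prop :=
  SolvesAlgebraicProblem φ ∧ HasGeometricGrowth (φ.comp arborification)

/-! ## Average algebras and well-behaved Rota-Baxter algebras -/

section WellBehaved

variable {A : Type} [CommRing A] [Algebra ℝ A]

/-- Average algebras. The algebra carries an augmentation `ε` whose kernel contains `γ` and the
image of `R̃ = id - R`; the compatibility of `θ`, `σ`, `R` modulo `ker Θ` is asked on `ker ε`. -/
structure IsAverageAlgebra (ε : A →ₗ[ℝ] ℝ) (R : A →ₗ[ℝ] A) (θ σ : A → A) (Θ : A →ₗ[ℝ] ℂ)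
    (γ : A) : Prop where
  ε_one : ε 1 = 1
  ε_mul : ∀ x y, ε (x * y) = ε x * ε y
  ε_γ : ε γ = 0
  ε_compl : ∀ x, ε (x - R x) = 0
  rotaBaxter : IsRotaBaxter (-1) R
  idempotent : ∀ x, R (R x) = R x
  σ_mul : ∀ b ∈ Set.range (fun x => x - R x), ∀ n : ℕ, σ (γ ^ n * b) = γ ^ n * σ b
  Θ_one : Θ 1 = 1
  Θ_mul : ∀ x y, Θ (x * y) = Θ x * Θ y
  Θ_γ : Θ γ = 1
  compat : ∀ x, ε x = 0 → θ (x - R x) - R (σ x) ∈ LinearMap.ker Θ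
  σ_γ : σ γ = γ
  vanish : ∀ b ∈ Set.range (fun x => x - R x), ∀ n : ℕ, R (γ ^ n * (σ b - R (σ b))) = 0

/-- Well-behaved Rota-Baxter algebras. The two inequalities are asked on a family `B` of elements
of the image of `R` which contains all the values produced by the Atkinson recursion on
arborified forests. -/
structure IsWellBehaved (ε : A →ₗ[ℝ] ℝ) (R : A →ₗ[ℝ] A) (θ σ : A → A) (Θ : A →ₗ[ℝ] ℂ)
    (γ : A) (v : A → A) (B : Set A) : Prop extends IsAverageAlgebra ε R θ σ Θ γ where
  v_one : v 1 = 1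
  v_mul : ∀ x y, v (x * y) = v x * v y
  subset_range : B ⊆ Set.range R
  iter_mem : ∀ (n : ℕ) (f : Forest),
    (iterR' R (mapa γ) n) (arborification (Hck.forest f)) ∈ B
  sum_mem : ∀ f : Forest, evalNegOne (seriesH R γ) (arborification (Hck.forest f)) ∈ B
  growth : ∃ k : ℝ, 0 < k ∧ ∀ (m : ℕ), ∀ b ∈ B,
    ‖Θ b‖ ≤ ‖Θ (v b)‖ ∧ ‖Θ (v (R (γ ^ m * b)))‖ ≤ k ^ m * ‖Θ (v b)‖

end WellBehaved

/-! ## The shuffle algebra data -/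

namespace Shuffle

/-- The augmentation: coefficient of the empty word. -/
def ε : Hsh →ₗ[ℝ] ℝ := counitL

/-- The projector that keeps the empty word and the words beginning by `1`, and kills the words
beginning by `2`. -/
def R : Hsh →ₗ[ℝ] Hsh := extend fun w =>
  match w with
  | [] => word []
  | .one :: u => word (.one :: u)
  | .two :: _ => 0

/-- The linear extension of the exchange of the letters `1` and `2`. -/
def σ : Hsh →ₗ[ℝ] Hsh := extend fun w => word (w.map Letter.bar)

/-- The exponential character, `w ↦ 1 / (length w)!`. -/
def Θ : Hsh →ₗ[ℝ] ℂ := extend fun w => 1 / (w.length.factorial : ℂ)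

/-- `γ = η + η̄`. -/
def γ (η : List Letter) : Hsh := word η + word (η.map Letter.bar)

/-- The homogeneous elements of the image of `R`. -/
def B : Set Hsh := {b | b ∈ Set.range R ∧ IsHomogeneous b}

end Shuffle

end

end RBAverages

open RBAverages

/-! Algebraic side. The words beginning with `2` span a non-unital subalgebra `Ker R`, and the empty
word together with the words beginning with `1` spans the subalgebra `Im R`. A projector with such
image and kernel is Rota-Baxter of weight `-1`. At `t = -1` the Atkinson series obeys `F(w n) =
-R(F(w) γⁿ)`. The Rota-Baxter identity turns this into multiplicativity once the quasi-shuffle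
product is unfolded from the last letter (`qsh_wordMul_snoc_snoc`, `evalNegOne_seriesF_wordMul`).

Write `I` for `mapI γ` and put `Y = σ ∘ F ∘ rev`. Away from the empty word, `F * I` and `Y` take
values in `Ker R`, while `F` and `I * Y` take values in `Im R` on all words. Hence `F * I * Y`,
bracketed in the two ways, lies in `Im R ∩ Ker R = 0` on every nonempty word, so it is the unit
(`convF_mul_mapI_mul_convY`). Applying `Θ`, which is real and `σ`-invariant and sends `I` to `ι`,
gives `φ * ι * (conj φ ∘ rev) = e`, the algebraic problem.

Growth inside the algebra. For `b` in `Im R` of length `l`, counting shuffles by their first letter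
gives `Θ(R(γⁿ b)) = (l + n)/(l + 2n) Θ(b)` for `n ≠ 0` (`Θ_R_γ_pow_mul`). The scalar is at most `1`,
so `k = 1` works. It also yields `φ(a₁…aᵣ) = ∏ -(2sᵢ₋₁ + aᵢ)/(2sᵢ)`, where the `sᵢ` are the partial
sums of the letters (`φ_word`).

Growth on forests. Expanding `α(f)` into words hides the cancellations, so `φ` is lifted to
polynomials on `[0,1]`: prepending `a` acts by `T_a P = -(xᵃP + ½∫ₓ¹ a yᵃ⁻¹P(y) dy)`. The identity
`tailOp_mul_tailOp` makes the lift multiplicative, and each `T_a` preserves the bound `|P| ≤ 1` on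
`[0,1]`, so all forests are bounded by `1` by induction on the tree structure. Evaluating the lift
at `0` returns `φ`: the moments against `s xˢ⁻¹ dx` intertwine `T_a` with the factors of the product
above (`moment_tailOp`). -/

namespace RBAverages

noncomputable section

namespace WordAlg

variable {Ω : Type}

/-! ### Gradings of word algebras -/

/-- The weight of a word whose letters are weighted by `g`. -/
def wt (g : Ω → ℕ) (w : List Ω) : ℕ := (w.map g).sum

@[simp] theorem wt_nil (g : Ω → ℕ) : wt g [] = 0 := rfl

@[simp] theorem wt_cons (g : Ω → ℕ) (a : Ω) (w : List Ω) : wt g (a :: w) = g a + wt g w := by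
  simp [wt]

@[simp] theorem wt_append (g : Ω → ℕ) (u v : List Ω) : wt g (u ++ v) = wt g u + wt g v := by
  simp [wt]

theorem wt_one_eq_length (w : List Ω) : wt (fun _ => 1) w = w.length := by
  induction w with
  | nil => rfl
  | cons a w ih => simp [ih, add_comm]

variable [Contraction Ω]

/-- The span of the words of weight `n`. -/
def graded (g : Ω → ℕ) (n : ℕ) : Submodule ℝ (WordAlg Ω) :=
  Submodule.span ℝ (word '' {w | wt g w = n})

theorem word_mem_graded (g : Ω → ℕ) (w : List Ω) : word w ∈ graded g (wt g w) :=
  Submodule.subset_span ⟨w, rfl, rfl⟩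

theorem map_mem_of_mem_graded {M : Type} [AddCommGroup M] [Module ℝ M] {g : Ω → ℕ} {n : ℕ}
    (f : WordAlg Ω →ₗ[ℝ] M) (S : Submodule ℝ M) (h : ∀ w, wt g w = n → f (word w) ∈ S)
    {x : WordAlg Ω} (hx : x ∈ graded g n) : f x ∈ S := by
  have : graded g n ≤ S.comap f := Submodule.span_le.2 (by rintro _ ⟨w, hw, rfl⟩; exact h w hw)
  exact this hx

theorem eq_of_mem_graded {M : Type} [AddCommGroup M] [Module ℝ M] {g : Ω → ℕ} {n : ℕ}
    (f f' : WordAlg Ω →ₗ[ℝ] M) (h : ∀ w, wt g w = n → f (word w) = f' (word w))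
    {x : WordAlg Ω} (hx : x ∈ graded g n) : f x = f' x := by
  have := map_mem_of_mem_graded (f - f') ⊥ (fun w hw => by simp [h w hw]) hx
  simpa [sub_eq_zero] using this

theorem eq_of_mem_graded₂ {M : Type} [AddCommGroup M] [Module ℝ M] {g : Ω → ℕ} {m n : ℕ}
    (f f' : WordAlg Ω →ₗ[ℝ] WordAlg Ω →ₗ[ℝ] M)
    (h : ∀ u v, wt g u = m → wt g v = n → f (word u) (word v) = f' (word u) (word v))
    {x y : WordAlg Ω} (hx : x ∈ graded g m) (hy : y ∈ graded g n) : f x y = f' x y :=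
  eq_of_mem_graded (f.flip y) (f'.flip y)
    (fun u hu => eq_of_mem_graded (f (word u)) (f' (word u)) (fun v hv => h u v hu hv) hy) hx

theorem prepend_mem_graded {g : Ω → ℕ} {n : ℕ} (a : Ω) {x : WordAlg Ω} (hx : x ∈ graded g n) :
    prepend a x ∈ graded g (g a + n) :=
  map_mem_of_mem_graded _ _ (fun w hw => by
    rw [prepend_word, ← hw, ← wt_cons]; exact word_mem_graded g _) hx

/-- Additivity of `g` under contraction is all the recursion needs. It holds vacuously for length on
the shuffle side and by definition for the sum of letters on the quasi-shuffle side. -/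
theorem wordMul_mem_graded {g : Ω → ℕ}
    (hg : ∀ a b c, Contraction.br a b = some c → g c = g a + g b) (u v : List Ω) :
    wordMul u v ∈ graded g (wt g u + wt g v) := by
  match u, v with
  | [], v => rw [wordMul_nil_left, wt_nil, zero_add]; exact word_mem_graded g v
  | a :: u, [] => rw [wordMul_nil_right, wt_nil, add_zero]; exact word_mem_graded g _
  | a :: u, b :: v =>
    rw [wordMul]
    refine Submodule.add_mem _ (Submodule.add_mem _ ?_ ?_) ?_
    · have := prepend_mem_graded a (wordMul_mem_graded hg u (b :: v))
      rwa [← add_assoc, ← wt_cons] at this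
    · have := prepend_mem_graded b (wordMul_mem_graded hg (a :: u) v)
      rwa [add_left_comm, ← wt_cons] at this
    · cases h : Contraction.br a b with
      | none => exact Submodule.zero_mem _
      | some c =>
        have := prepend_mem_graded c (wordMul_mem_graded hg u v)
        rw [hg a b c h] at this
        rw [wt_cons, wt_cons, add_add_add_comm]
        exact this
termination_by u.length + v.length

theorem mul_mem_graded {g : Ω → ℕ}
    (hg : ∀ a b c, Contraction.br a b = some c → g c = g a + g b) {m n : ℕ} {x y : WordAlg Ω}
    (hx : x ∈ graded g m) (hy : y ∈ graded g n) : x * y ∈ graded g (m + n) := by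
  refine map_mem_of_mem_graded (mulL.flip y) _ (fun u hu => ?_) hx
  refine map_mem_of_mem_graded (mulL (word u)) _ (fun v hv => ?_) hy
  rw [← mul_def, word_mul_word, ← hu, ← hv]
  exact wordMul_mem_graded hg u v

theorem one_mem_graded (g : Ω → ℕ) : (1 : WordAlg Ω) ∈ graded g 0 := word_mem_graded g []

theorem pow_mem_graded {g : Ω → ℕ}
    (hg : ∀ a b c, Contraction.br a b = some c → g c = g a + g b) {m : ℕ} {x : WordAlg Ω}
    (hx : x ∈ graded g m) (n : ℕ) : x ^ n ∈ graded g (m * n) := by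
  induction n with
  | zero => exact one_mem_graded g
  | succ n ih => rw [pow_succ, mul_add, mul_one]; exact mul_mem_graded hg ih hx

theorem isHomogeneous_iff {x : WordAlg Ω} :
    IsHomogeneous x ↔ ∃ l, x ∈ graded (fun _ => 1) l := by
  have key (l : ℕ) : x ∈ graded (fun _ => 1) l ↔ ∀ w, coef x w ≠ 0 → w.length = l := by
    have h : graded (fun _ => 1) l
        = (Finsupp.supported ℝ ℝ {w : List Ω | wt (fun _ => 1) w = l} :
            Submodule ℝ (List Ω →₀ ℝ)) :=
      (Finsupp.supported_eq_span_single ℝ _).symm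
    rw [h]
    refine Iff.trans (Finsupp.mem_supported ℝ (M := ℝ) (s := {w : List Ω | wt (fun _ => 1) w = l})
      (show List Ω →₀ ℝ from x)) ?_
    constructor
    · intro h w hw
      have := h (Finsupp.mem_support_iff.2 hw)
      rwa [Set.mem_ofPred_eq, wt_one_eq_length] at this
    · intro h w hw
      rw [Set.mem_ofPred_eq, wt_one_eq_length]
      exact h w (Finsupp.mem_support_iff.1 hw)
  simp only [key]
  rfl

theorem algHom_mul_of_word {B : Type} [CommRing B] [Algebra ℝ B] (f : WordAlg Ω →ₗ[ℝ] B)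
    (h : ∀ u v, f (wordMul u v) = f (word u) * f (word v)) (x y : WordAlg Ω) :
    f (x * y) = f x * f y := by
  have e : mulL.compr₂ f = (LinearMap.mul ℝ B).compl₁₂ f f :=
    hom_ext fun u => hom_ext fun v => by
      simp [← mul_def, h]
  exact LinearMap.congr_fun₂ e x y

/-! ### Convolution on words -/

section Conv

variable {B : Type} [CommRing B] [Algebra ℝ B]

theorem conv_word (f g : WithConv (WordAlg Ω →ₗ[ℝ] B)) (w : List Ω) :
    (f * g) (word w)
      = ∑ i ∈ Finset.range (w.length + 1), f (word (w.take i)) * g (word (w.drop i)) := by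
  have : CoalgebraStruct.comul (R := ℝ) (word w) = comulL (word w) := rfl
  rw [LinearMap.convMul_apply, this, comulL, extend_word, map_sum, map_sum]
  simp

theorem conv_one_nil : (1 : WithConv (WordAlg Ω →ₗ[ℝ] B)) (word []) = 1 := by
  have : CoalgebraStruct.counit (R := ℝ) (word ([] : List Ω)) = counitL (word []) := rfl
  rw [LinearMap.convOne_apply, this, counitL, extend_word]
  simp

theorem conv_one_of_ne_nil {w : List Ω} (hw : w ≠ []) :
    (1 : WithConv (WordAlg Ω →ₗ[ℝ] B)) (word w) = 0 := by
  have : CoalgebraStruct.counit (R := ℝ) (word w) = counitL (word w) := rfl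
  rw [LinearMap.convOne_apply, this, counitL, extend_word]
  simp [hw]

theorem conv_ext {f g : WithConv (WordAlg Ω →ₗ[ℝ] B)} (h : ∀ w, f (word w) = g (word w)) :
    f = g :=
  WithConv.ext (hom_ext h)

theorem conv_nil (f g : WithConv (WordAlg Ω →ₗ[ℝ] B)) :
    (f * g) (word []) = f (word []) * g (word []) := by
  rw [conv_word]
  simp

/-- The values on words of the right convolution inverse of a map equal to `1` on the empty
word. -/
def convInvFun (f : List Ω → B) (w : List Ω) : B :=
  if w = [] then 1 else
    -∑ i : Fin w.length, f (w.take (i + 1)) * convInvFun f (w.drop (i + 1))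
termination_by w.length
decreasing_by have := i.2; simp only [List.length_drop]; omega

/-- Since `f(∅) = 1`, the equation `(f * g)(w) = 0` determines `g(w)` from the values of `g` on
strictly shorter suffixes. -/
theorem exists_conv_right_inv (f : WithConv (WordAlg Ω →ₗ[ℝ] B)) (hf : f (word []) = 1) :
    ∃ g : WithConv (WordAlg Ω →ₗ[ℝ] B), g (word []) = 1 ∧ f * g = 1 := by
  have hnil : (WithConv.toConv (extend (convInvFun fun w => f (word w)) :
      WordAlg Ω →ₗ[ℝ] B)) (word []) = 1 := by
    rw [extend_word, convInvFun, if_pos rfl]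
  refine ⟨WithConv.toConv (extend (convInvFun fun w => f (word w))), hnil, conv_ext fun w => ?_⟩
  by_cases hw : w = []
  · rw [hw, conv_nil, hf, hnil, conv_one_nil, mul_one]
  · rw [conv_one_of_ne_nil hw, conv_word, Finset.sum_range_succ', List.take_zero, hf, one_mul,
      List.drop_zero]
    simp only [extend_word]
    conv_lhs => rw [convInvFun]
    rw [if_neg hw, Finset.sum_range, add_neg_cancel]

theorem exists_conv_unit (f : WithConv (WordAlg Ω →ₗ[ℝ] B)) (hf : f (word []) = 1) :
    ∃ u : (WithConv (WordAlg Ω →ₗ[ℝ] B))ˣ, (u : WithConv (WordAlg Ω →ₗ[ℝ] B)) = f := by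
  obtain ⟨g, hg, hfg⟩ := exists_conv_right_inv f hf
  obtain ⟨h, -, hgh⟩ := exists_conv_right_inv g hg
  -- A right inverse `g` that itself has a right inverse `h` is two-sided, because `f = f g h = h`.
  have : f = h := by rw [← mul_one f, ← hgh, ← mul_assoc, hfg, one_mul]
  exact ⟨⟨f, g, hfg, this ▸ hgh⟩, rfl⟩

end Conv

end WordAlg

open WordAlg

/-! ## The shuffle algebra on two letters -/

namespace Shuffle

theorem length_additive (a b c : Letter) (h : Contraction.br a b = some c) :
    (fun _ : Letter => 1) c = (fun _ : Letter => 1) a + (fun _ : Letter => 1) b := by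
  cases h

theorem wordMul_cons_cons (a b : Letter) (u v : List Letter) :
    wordMul (a :: u) (b :: v)
      = prepend a (wordMul u (b :: v)) + prepend b (wordMul (a :: u) v) := by
  rw [wordMul]
  exact add_zero _

@[simp] theorem bar_bar (a : Letter) : a.bar.bar = a := by cases a <;> rfl

/-! ### The projector -/

@[simp] theorem R_nil : R (word []) = word [] := extend_word _ _

@[simp] theorem R_one (w : List Letter) : R (word (.one :: w)) = word (.one :: w) :=
  extend_word _ _

@[simp] theorem R_two (w : List Letter) : R (word (.two :: w)) = 0 := extend_word _ _

@[simp] theorem R_prepend_one (x : Hsh) : R (prepend .one x) = prepend .one x := by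
  have : R ∘ₗ prepend .one = prepend .one := hom_ext fun w => by simp
  exact LinearMap.congr_fun this x

@[simp] theorem R_prepend_two (x : Hsh) : R (prepend .two x) = 0 := by
  have : R ∘ₗ prepend .two = 0 := hom_ext fun w => by simp
  exact LinearMap.congr_fun this x

@[simp] theorem R_R (x : Hsh) : R (R x) = R x := by
  have : R ∘ₗ R = R := hom_ext fun w => by
    match w with
    | [] => simp
    | .one :: w => simp
    | .two :: w => simp
  exact LinearMap.congr_fun this x

theorem R_one_eq : R (1 : Hsh) = 1 := R_nil

/-- A shuffle of two words beginning with `1` begins with `1`, so `Im R` is a subalgebra. -/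
theorem R_mul_R (x y : Hsh) : R (R x * R y) = R x * R y := by
  have : (mulL.compl₁₂ R R).compr₂ R = mulL.compl₁₂ R R :=
    hom_ext fun u => hom_ext fun v => by
      simp only [LinearMap.compr₂_apply, LinearMap.compl₁₂_apply, ← mul_def]
      match u, v with
      | [], v => rw [R_nil, ← one_def, one_mul, R_R]
      | .two :: u, v => rw [R_two, zero_mul, map_zero]
      | .one :: u, [] => rw [R_nil, ← one_def, mul_one, R_R]
      | .one :: u, .two :: v => rw [R_two, mul_zero, map_zero]
      | .one :: u, .one :: v => simp [wordMul_cons_cons]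
  exact LinearMap.congr_fun₂ this x y

/-- The same first-letter argument with `2`: `Ker R` is closed under products. -/
theorem R_compl_mul_compl (x y : Hsh) : R ((x - R x) * (y - R y)) = 0 := by
  have : (mulL.compl₁₂ (LinearMap.id - R) (LinearMap.id - R)).compr₂ R = 0 :=
    hom_ext fun u => hom_ext fun v => by
      simp only [LinearMap.compr₂_apply, LinearMap.compl₁₂_apply, ← mul_def, LinearMap.sub_apply,
        LinearMap.id_apply, LinearMap.zero_apply]
      match u, v with
      | [], v => simp
      | .one :: u, v => simp
      | .two :: u, [] => simp
      | .two :: u, .one :: v => simp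
      | .two :: u, .two :: v => simp [wordMul_cons_cons]
  exact LinearMap.congr_fun₂ this x y

theorem R_mul_of_R_eq {x y : Hsh} (hx : R x = x) (hy : R y = y) : R (x * y) = x * y := by
  rw [← hx, ← hy, R_mul_R]

theorem R_mul_of_R_eq_zero {x y : Hsh} (hx : R x = 0) (hy : R y = 0) : R (x * y) = 0 := by
  have := R_compl_mul_compl x y
  rwa [hx, hy, sub_zero, sub_zero] at this

theorem rotaBaxter_R : IsRotaBaxter (-1) R := by
  intro x y
  have h : R x * y + x * R y + (-1 : ℝ) • (x * y) = R x * R y - (x - R x) * (y - R y) := by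
    rw [neg_smul, one_smul]
    ring
  rw [h, map_sub, R_compl_mul_compl, R_mul_R, sub_zero]

theorem R_mem_graded {n : ℕ} {x : Hsh} (hx : x ∈ graded (fun _ => 1) n) :
    R x ∈ graded (fun _ => 1) n := by
  refine map_mem_of_mem_graded _ _ (fun w hw => ?_) hx
  match w with
  | [] => rw [R_nil, ← hw]; exact word_mem_graded _ _
  | .one :: w => rw [R_one, ← hw]; exact word_mem_graded _ _
  | .two :: w => rw [R_two]; exact Submodule.zero_mem _

/-! ### The augmentation -/

@[simp] theorem ε_nil : ε (word []) = 1 := by simp [ε, counitL]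

@[simp] theorem ε_cons (a : Letter) (w : List Letter) : ε (word (a :: w)) = 0 := by
  simp [ε, counitL]

@[simp] theorem ε_prepend (a : Letter) (x : Hsh) : ε (prepend a x) = 0 :=
  LinearMap.congr_fun (counitL_comp_prepend a) x

theorem ε_R (x : Hsh) : ε (R x) = ε x := by
  have : ε ∘ₗ R = ε := hom_ext fun w => by
    match w with
    | [] => simp
    | .one :: w => simp
    | .two :: w => simp
  exact LinearMap.congr_fun this x

theorem ε_mul (x y : Hsh) : ε (x * y) = ε x * ε y := by
  refine algHom_mul_of_word ε (fun u v => ?_) x y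
  match u, v with
  | [], v => simp [wordMul_nil_left]
  | a :: u, [] => simp [wordMul_nil_right]
  | a :: u, b :: v => simp [wordMul_cons_cons]

theorem ε_eq_zero_of_mem_graded {n : ℕ} (hn : n ≠ 0) {x : Hsh}
    (hx : x ∈ graded (fun _ => 1) n) : ε x = 0 := by
  refine map_mem_of_mem_graded ε ⊥ (fun w hw => ?_) hx
  cases w with
  | nil => exact absurd hw.symm hn
  | cons a w => exact ε_cons a w

/-! ### The exchange of the letters -/

@[simp] theorem σ_word (w : List Letter) : σ (word w) = word (w.map Letter.bar) := extend_word _ _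

@[simp] theorem σ_prepend (a : Letter) (x : Hsh) : σ (prepend a x) = prepend a.bar (σ x) := by
  have : σ ∘ₗ prepend a = prepend a.bar ∘ₗ σ := hom_ext fun w => by simp
  exact LinearMap.congr_fun this x

theorem σ_wordMul (u v : List Letter) : σ (wordMul u v) = σ (word u) * σ (word v) := by
  match u, v with
  | [], v => simp [wordMul_nil_left]
  | a :: u, [] => simp [wordMul_nil_right]
  | a :: u, b :: v =>
    have h1 := σ_wordMul u (b :: v)
    have h2 := σ_wordMul (a :: u) v
    simp only [σ_word, word_mul_word, List.map_cons] at h1 h2 ⊢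
    rw [wordMul_cons_cons, wordMul_cons_cons, map_add, σ_prepend, σ_prepend, h1, h2]
termination_by u.length + v.length

theorem σ_mul (x y : Hsh) : σ (x * y) = σ x * σ y := algHom_mul_of_word σ σ_wordMul x y

theorem σ_one : σ (1 : Hsh) = 1 := σ_word []

theorem σ_pow (x : Hsh) (n : ℕ) : σ (x ^ n) = σ x ^ n := by
  induction n with
  | zero => simp [σ_one]
  | succ n ih => rw [pow_succ, pow_succ, σ_mul, ih]

/-- Exchanging the letters exchanges the two summands of nonempty words. The empty word is the only
defect, since it is fixed by both `R` and `σ`; this is why `ε x = 0` is required. -/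
theorem σ_compl (x : Hsh) (hx : ε x = 0) : σ (x - R x) = R (σ x) := by
  have h : σ ∘ₗ (LinearMap.id - R) - R ∘ₗ σ = -(ε.smulRight (1 : Hsh)) := hom_ext fun w => by
    match w with
    | [] => simp [one_def]
    | .one :: w => simp [Letter.bar]
    | .two :: w => simp [Letter.bar]
  have := LinearMap.congr_fun h x
  simpa [hx, sub_eq_zero] using this

theorem σ_R (x : Hsh) (hx : ε x = 0) : σ (R x) = σ x - R (σ x) := by
  rw [← σ_compl x hx, map_sub, sub_sub_cancel]

/-! ### The exponential character -/

theorem Θ_word (w : List Letter) : Θ (word w) = 1 / (w.length.factorial : ℂ) := extend_word _ _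

@[simp] theorem Θ_nil : Θ (word []) = 1 := by simp [Θ_word]

theorem Θ_one : Θ 1 = 1 := Θ_nil

theorem Θ_cons (a : Letter) (w : List Letter) :
    Θ (word (a :: w)) = ((w.length + 1 : ℕ) : ℂ)⁻¹ * Θ (word w) := by
  rw [Θ_word, Θ_word, List.length_cons, Nat.factorial_succ, Nat.cast_mul, one_div, one_div,
    mul_inv]

theorem Θ_prepend {n : ℕ} (a : Letter) {x : Hsh} (hx : x ∈ graded (fun _ => 1) n) :
    Θ (prepend a x) = ((n + 1 : ℕ) : ℂ)⁻¹ * Θ x := by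
  refine eq_of_mem_graded (Θ ∘ₗ prepend a) (((n + 1 : ℕ) : ℂ)⁻¹ • Θ) (fun w hw => ?_) hx
  rw [wt_one_eq_length] at hw
  rw [LinearMap.comp_apply, prepend_word, Θ_cons, hw, LinearMap.smul_apply, smul_eq_mul]

/-- There are `(p+q)!/(p! q!)` shuffles of words of lengths `p` and `q`, each weighted `1/(p+q)!`.
The induction is Pascal's rule. -/
theorem Θ_wordMul (u v : List Letter) : Θ (wordMul u v) = Θ (word u) * Θ (word v) := by
  match u, v with
  | [], v => simp [wordMul_nil_left]
  | a :: u, [] => simp [wordMul_nil_right]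
  | a :: u, b :: v =>
    have h1 := wordMul_mem_graded length_additive u (b :: v)
    have h2 := wordMul_mem_graded length_additive (a :: u) v
    rw [wordMul_cons_cons, map_add, Θ_prepend a h1, Θ_prepend b h2, Θ_wordMul u (b :: v),
      Θ_wordMul (a :: u) v, Θ_cons, Θ_cons]
    simp only [wt_one_eq_length, List.length_cons]
    push_cast
    have e1 : (u.length + 1 : ℂ) ≠ 0 := by
      exact_mod_cast (by omega : u.length + 1 ≠ 0)
    have e2 : (v.length + 1 : ℂ) ≠ 0 := by
      exact_mod_cast (by omega : v.length + 1 ≠ 0)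
    have e3 : (u.length + (v.length + 1) + 1 : ℂ) ≠ 0 := by
      exact_mod_cast (by omega : u.length + (v.length + 1) + 1 ≠ 0)
    have e4 : (u.length + 1 + v.length + 1 : ℂ) ≠ 0 := by
      exact_mod_cast (by omega : u.length + 1 + v.length + 1 ≠ 0)
    field_simp
    ring
termination_by u.length + v.length

theorem Θ_mul (x y : Hsh) : Θ (x * y) = Θ x * Θ y := algHom_mul_of_word Θ Θ_wordMul x y

/-- The exponential character as a morphism of algebras. -/
def ΘHom : Hsh →ₐ[ℝ] ℂ := AlgHom.ofLinearMap Θ Θ_one Θ_mul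

@[simp] theorem ΘHom_apply (x : Hsh) : ΘHom x = Θ x := rfl

theorem Θ_σ (x : Hsh) : Θ (σ x) = Θ x := by
  have : Θ ∘ₗ σ = Θ := hom_ext fun w => by simp [Θ_word]
  exact LinearMap.congr_fun this x

/-- Among the shuffles of a word beginning with `2` of length `m` and a word beginning with `1` of
length `l`, the proportion starting with `1` is `l/(l+m)`. -/
theorem Θ_R_compl_mul {l m : ℕ} {b g : Hsh} (hb : b ∈ graded (fun _ => 1) l)
    (hg : g ∈ graded (fun _ => 1) m) :
    Θ (R ((g - R g) * R b)) = (l / (l + m : ℂ)) * (Θ (g - R g) * Θ (R b)) := by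
  have key := eq_of_mem_graded₂ ((mulL.compl₁₂ (LinearMap.id - R) R).compr₂ (Θ ∘ₗ R))
    ((l / (l + m : ℂ)) •
      (LinearMap.mul ℝ ℂ).compl₁₂ (Θ ∘ₗ (LinearMap.id - R)) (Θ ∘ₗ R))
    (fun u v hu hv => ?_) hg hb
  · exact key
  simp only [LinearMap.compr₂_apply, LinearMap.compl₁₂_apply, LinearMap.comp_apply, ← mul_def,
    LinearMap.sub_apply, LinearMap.id_apply, LinearMap.smul_apply, LinearMap.mul_apply',
    smul_eq_mul]
  match u, v with
  | [], v => simp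
  | .one :: u, v => simp
  | .two :: u, .two :: v => simp
  | .two :: u, [] =>
    have : l = 0 := hv.symm
    simp [wordMul_nil_right, this]
  | .two :: u, .one :: v =>
    rw [R_two, R_one, sub_zero, word_mul_word, wordMul_cons_cons, map_add, R_prepend_one,
      R_prepend_two, zero_add, Θ_prepend _ (wordMul_mem_graded length_additive _ _), Θ_wordMul,
      Θ_cons .one v, ← hu, ← hv]
    simp only [wt_one_eq_length, List.length_cons]
    push_cast
    have e1 : (u.length + 1 : ℂ) ≠ 0 := by
      exact_mod_cast (by omega : u.length + 1 ≠ 0)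
    have e2 : (v.length + 1 : ℂ) ≠ 0 := by
      exact_mod_cast (by omega : v.length + 1 ≠ 0)
    have e3 : (u.length + 1 + v.length + 1 : ℂ) ≠ 0 := by
      exact_mod_cast (by omega : u.length + 1 + v.length + 1 ≠ 0)
    have e4 : (v.length + 1 + (u.length + 1) : ℂ) ≠ 0 := by
      exact_mod_cast (by omega : v.length + 1 + (u.length + 1) ≠ 0)
    field_simp
    ring

/-- Multiplication by a symmetric homogeneous element, followed by the projector, acts by a scalar
under the exponential character. -/
theorem Θ_R_mul {l m : ℕ} (hm : m ≠ 0) {b g : Hsh} (hb : b ∈ graded (fun _ => 1) l)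
    (hRb : R b = b) (hg : g ∈ graded (fun _ => 1) m) (hσ : σ g = g) :
    Θ (R (g * b)) = ((2 * l + m) / (2 * (l + m)) : ℂ) * (Θ g * Θ b) := by
  have hε := ε_eq_zero_of_mem_graded hm hg
  -- By symmetry each half of `g` carries half of `Θ g`. The half in `Im R` contributes fully and
  -- the other in proportion `l/(l+m)`, whence `½ + ½ l/(l+m)`.
  have h1 : Θ (g - R g) = Θ (R g) := by rw [← Θ_σ (g - R g), σ_compl g hε, hσ]
  have h2 : Θ g = 2 * Θ (R g) := by
    rw [map_sub, sub_eq_iff_eq_add] at h1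
    rw [h1]
    ring
  have h3 : g * b = R g * R b + (g - R g) * R b := by rw [hRb]; ring
  have e : (l + m : ℂ) ≠ 0 := by
    exact_mod_cast (by omega : l + m ≠ 0)
  rw [h3, map_add, R_mul_R, map_add, Θ_mul, Θ_R_compl_mul hb hg, h1, hRb, h2]
  field_simp
  ring

/-! ### The element `γ` -/

variable {η : List Letter}

theorem γ_mem_graded (η : List Letter) : γ η ∈ graded (fun _ => 1) η.length := by
  refine Submodule.add_mem _ ?_ ?_
  · have := word_mem_graded (fun _ => 1) η
    rwa [wt_one_eq_length] at this
  · have := word_mem_graded (fun _ => 1) (η.map Letter.bar)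
    rwa [wt_one_eq_length, List.length_map] at this

theorem γ_pow_mem_graded (hη : η.length = 2) (n : ℕ) :
    γ η ^ n ∈ graded (fun _ => 1) (2 * n) := by
  have := pow_mem_graded length_additive (γ_mem_graded η) n
  rwa [hη] at this

theorem σ_γ (η : List Letter) : σ (γ η) = γ η := by
  simp [γ, Function.comp_def, add_comm]

theorem σ_γ_pow (η : List Letter) (n : ℕ) : σ (γ η ^ n) = γ η ^ n := by rw [σ_pow, σ_γ]

theorem Θ_γ (hη : η.length = 2) : Θ (γ η) = 1 := by
  rw [γ, map_add, Θ_word, Θ_word, List.length_map, hη]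
  norm_num [Nat.factorial]

theorem Θ_γ_pow (hη : η.length = 2) (n : ℕ) : Θ (γ η ^ n) = 1 := by
  rw [← ΘHom_apply, map_pow, ΘHom_apply, Θ_γ hη, one_pow]

theorem Θ_R_γ_pow_mul (hη : η.length = 2) {n : ℕ} (hn : n ≠ 0) {l : ℕ} {b : Hsh}
    (hb : b ∈ graded (fun _ => 1) l) (hRb : R b = b) :
    Θ (R (γ η ^ n * b)) = ((l + n) / (l + 2 * n) : ℂ) * Θ b := by
  rw [Θ_R_mul (by omega) hb hRb (γ_pow_mem_graded hη n) (σ_γ_pow η n), Θ_γ_pow hη, one_mul]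
  have e : (l + 2 * n : ℂ) ≠ 0 := by
      exact_mod_cast (by omega : l + 2 * n ≠ 0)
  push_cast
  congr 1
  field_simp

theorem norm_Θ_R_γ_pow_mul_le (hη : η.length = 2) (n : ℕ) {l : ℕ} {b : Hsh}
    (hb : b ∈ graded (fun _ => 1) l) (hRb : R b = b) : ‖Θ (R (γ η ^ n * b))‖ ≤ ‖Θ b‖ := by
  -- For `n = 0` the scalar formula is not available: at `l = 0` it would read `0/0`.
  rcases eq_or_ne n 0 with rfl | hn
  · rw [pow_zero, one_mul, hRb]
  · rw [Θ_R_γ_pow_mul hη hn hb hRb, norm_mul]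
    refine mul_le_of_le_one_left (norm_nonneg _) ?_
    rw [norm_div]
    refine div_le_one_of_le₀ ?_ (norm_nonneg _)
    have e1 : (l + n : ℂ) = ((l + n : ℕ) : ℂ) := by push_cast; rfl
    have e2 : (l + 2 * n : ℂ) = ((l + 2 * n : ℕ) : ℂ) := by push_cast; rfl
    rw [e1, e2, Complex.norm_natCast, Complex.norm_natCast]
    exact_mod_cast (by omega)

end Shuffle

/-! ## The quasi-shuffle product from the right -/

namespace WordAlg

/-- Appending a letter on the right. -/
def snoc {Ω : Type} [Contraction Ω] (a : Ω) : WordAlg Ω →ₗ[ℝ] WordAlg Ω :=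
  extend fun w => word (w ++ [a])

@[simp] theorem snoc_word {Ω : Type} [Contraction Ω] (a : Ω) (w : List Ω) :
    snoc a (word w) = word (w ++ [a]) := extend_word _ _

theorem snoc_prepend {Ω : Type} [Contraction Ω] (a b : Ω) (x : WordAlg Ω) :
    snoc a (prepend b x) = prepend b (snoc a x) := by
  have : snoc a ∘ₗ prepend b = prepend b ∘ₗ snoc a := hom_ext fun w => by simp
  exact LinearMap.congr_fun this x

theorem qsh_wordMul_cons_cons (a b : ℕ+) (u v : List ℕ+) :
    wordMul (a :: u) (b :: v)
      = prepend a (wordMul u (b :: v)) + prepend b (wordMul (a :: u) v)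
        + prepend (a + b) (wordMul u v) := by
  rw [wordMul]
  rfl

/-- The product is defined by peeling first letters, but `F` is computed by peeling last letters;
the two recursions agree by the left-right symmetry of the quasi-shuffle. -/
theorem qsh_wordMul_snoc_snoc (a b : ℕ+) (u v : List ℕ+) :
    wordMul (u ++ [a]) (v ++ [b])
      = snoc a (wordMul u (v ++ [b])) + snoc b (wordMul (u ++ [a]) v)
        + snoc (a + b) (wordMul u v) := by
  match u, v with
  | [], [] =>
    simp only [List.nil_append, qsh_wordMul_cons_cons, wordMul_nil_left, wordMul_nil_right,
      snoc_word, prepend_word, List.cons_append]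
    abel
  | [], d :: v =>
    have h := qsh_wordMul_snoc_snoc a b [] v
    simp only [List.nil_append, List.cons_append, qsh_wordMul_cons_cons, wordMul_nil_left,
      snoc_word, prepend_word, map_add, snoc_prepend] at h ⊢
    rw [h]
    simp only [map_add, prepend_word]
    abel
  | c :: u, [] =>
    have h := qsh_wordMul_snoc_snoc a b u []
    simp only [List.nil_append, List.cons_append, qsh_wordMul_cons_cons, wordMul_nil_right,
      snoc_word, prepend_word, map_add, snoc_prepend] at h ⊢
    rw [h]
    simp only [map_add, prepend_word]
    abel
  | c :: u, d :: v =>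
    have h1 := qsh_wordMul_snoc_snoc a b u (d :: v)
    have h2 := qsh_wordMul_snoc_snoc a b (c :: u) v
    have h3 := qsh_wordMul_snoc_snoc a b u v
    simp only [List.cons_append] at h1 h2 ⊢
    simp only [qsh_wordMul_cons_cons c d, h1, h2, h3, map_add, snoc_prepend]
    abel
termination_by u.length + v.length

end WordAlg

/-! ## The Atkinson recursion on words -/

section Atkinson

variable {A : Type} [CommRing A] [Algebra ℝ A]

theorem mapI_nil (γ : A) : mapI γ (word []) = 1 := extend_word _ _

theorem mapI_singleton (γ : A) (n : ℕ+) : mapI γ (word [n]) = γ ^ (n : ℕ) := extend_word _ _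

theorem mapI_cons_cons (γ : A) (m n : ℕ+) (w : List ℕ+) : mapI γ (word (m :: n :: w)) = 0 :=
  extend_word _ _

theorem mapa_nil (γ : A) : mapa γ (word []) = 0 := by
  have : mapa γ (word []) = mapI γ (word []) - (1 : Conv A) (word []) := rfl
  rw [this, mapI_nil, conv_one_nil, sub_self]

theorem mapa_of_ne_nil (γ : A) {w : List ℕ+} (hw : w ≠ []) :
    mapa γ (word w) = mapI γ (word w) := by
  have : mapa γ (word w) = mapI γ (word w) - (1 : Conv A) (word w) := rfl
  rw [this, conv_one_of_ne_nil hw, sub_zero]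

theorem mapI_of_two_le_length (γ : A) {w : List ℕ+} (hw : 2 ≤ w.length) :
    mapI γ (word w) = 0 := by
  match w with
  | [] => simp at hw
  | [n] => simp at hw
  | m :: n :: w => exact mapI_cons_cons γ m n w

/-- `mapI γ` sees only suffixes of length at most one, so just the last two cuts survive. -/
theorem conv_mapI_append (γ : A) (f : Conv A) (w : List ℕ+) (n : ℕ+) :
    (f * mapI γ) (word (w ++ [n])) = f (word (w ++ [n])) + f (word w) * γ ^ (n : ℕ) := by
  rw [conv_word, List.length_append, List.length_singleton, Finset.sum_range_succ,
    Finset.sum_range_succ, Finset.sum_eq_zero, zero_add, add_comm]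
  · congr 1
    · rw [List.take_of_length_le (by simp), List.drop_of_length_le (by simp), mapI_nil, mul_one]
    · rw [List.take_left, List.drop_left, mapI_singleton]
  · intro i hi
    rw [Finset.mem_range] at hi
    rw [mapI_of_two_le_length γ, mul_zero]
    simp only [List.length_drop, List.length_append, List.length_singleton]
    omega

theorem conv_mapa_append (γ : A) (f : Conv A) (w : List ℕ+) (n : ℕ+) :
    (f * mapa γ) (word (w ++ [n])) = f (word w) * γ ^ (n : ℕ) := by
  have : (f * mapa γ) (word (w ++ [n]))
      = (f * mapI γ) (word (w ++ [n])) - f (word (w ++ [n])) := by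
    rw [mapa, mul_sub, mul_one]
    rfl
  rw [this, conv_mapI_append, add_sub_cancel_left]

theorem conv_mapI_cons (γ : A) (f : Conv A) (n : ℕ+) (w : List ℕ+) :
    (mapI γ * f) (word (n :: w)) = f (word (n :: w)) + γ ^ (n : ℕ) * f (word w) := by
  rw [conv_word, List.length_cons, Finset.sum_range_succ', Finset.sum_range_succ',
    Finset.sum_eq_zero, zero_add, add_comm]
  · congr 1
    · rw [List.take_zero, List.drop_zero, mapI_nil, one_mul]
    · rw [zero_add, List.take_succ_cons, List.take_zero, List.drop_succ_cons, List.drop_zero,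
        mapI_singleton]
  · intro i hi
    rw [Finset.mem_range] at hi
    rw [mapI_of_two_le_length γ, zero_mul]
    simp only [List.length_take, List.length_cons]
    omega

theorem iterR_succ_append (R : A →ₗ[ℝ] A) (γ : A) (k : ℕ) (w : List ℕ+) (n : ℕ+) :
    iterR R (mapa γ) (k + 1) (word (w ++ [n]))
      = R (iterR R (mapa γ) k (word w) * γ ^ (n : ℕ)) :=
  congrArg R (conv_mapa_append γ _ w n)

theorem iterR_succ_nil (R : A →ₗ[ℝ] A) (γ : A) (k : ℕ) :
    iterR R (mapa γ) (k + 1) (word []) = 0 := by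
  refine (congrArg R ?_).trans (map_zero R)
  exact (conv_nil (iterR R (mapa γ) k) (mapa γ)).trans (by rw [mapa_nil, mul_zero])

theorem iterR_eq_zero (R : A →ₗ[ℝ] A) (γ : A) (n : ℕ) (w : List ℕ+) (h : w.length < n) :
    iterR R (mapa γ) n (word w) = 0 := by
  induction n generalizing w with
  | zero => simp at h
  | succ n ih =>
    rcases List.eq_nil_or_concat' w with rfl | ⟨w, a, rfl⟩
    · exact iterR_succ_nil R γ n
    · rw [iterR_succ_append, ih w (by simpa using h), zero_mul, map_zero]

theorem evalNegOne_seriesF_word (R : A →ₗ[ℝ] A) (γ : A) (w : List ℕ+) :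
    evalNegOne (seriesF R γ) (word w)
      = ∑ k ∈ Finset.range (w.length + 1), (-1 : ℝ) ^ k • iterR R (mapa γ) k (word w) := by
  rw [evalNegOne, extend_word]
  simp only [seriesF, PowerSeries.coeff_mk]

theorem evalNegOne_seriesH_word (R : A →ₗ[ℝ] A) (γ : A) (w : List ℕ+) :
    evalNegOne (seriesH R γ) (word w)
      = ∑ k ∈ Finset.range (w.length + 1), (-1 : ℝ) ^ k • iterR' R (mapa γ) k (word w) := by
  rw [evalNegOne, extend_word]
  simp only [seriesH, PowerSeries.coeff_mk]

theorem evalNegOne_seriesF_nil (R : A →ₗ[ℝ] A) (γ : A) :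
    evalNegOne (seriesF R γ) (word []) = 1 := by
  rw [evalNegOne_seriesF_word, List.length_nil, zero_add, Finset.sum_range_one, pow_zero, one_smul]
  exact conv_one_nil

theorem evalNegOne_seriesF_append (R : A →ₗ[ℝ] A) (γ : A) (w : List ℕ+) (n : ℕ+) :
    evalNegOne (seriesF R γ) (word (w ++ [n]))
      = -R (evalNegOne (seriesF R γ) (word w) * γ ^ (n : ℕ)) := by
  -- With the term of index `0` gone, the truncation at `length w + 1` shifts exactly onto the
  -- truncation for `w`.
  have h0 : iterR R (mapa γ) 0 (word (w ++ [n])) = 0 := conv_one_of_ne_nil (by simp)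
  rw [evalNegOne_seriesF_word, evalNegOne_seriesF_word, List.length_append, List.length_singleton,
    Finset.sum_range_succ', h0, smul_zero, add_zero, Finset.sum_mul, map_sum,
    ← Finset.sum_neg_distrib]
  refine Finset.sum_congr rfl fun k _ => ?_
  rw [iterR_succ_append, smul_mul_assoc, map_smul, pow_succ, mul_neg_one, neg_smul]

theorem evalNegOne_seriesF_snoc (R : A →ₗ[ℝ] A) (γ : A) (n : ℕ+) (x : Hqsh) :
    evalNegOne (seriesF R γ) (snoc n x)
      = -R (evalNegOne (seriesF R γ) x * γ ^ (n : ℕ)) := by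
  have : evalNegOne (seriesF R γ) ∘ₗ snoc n
      = -(R ∘ₗ LinearMap.mulRight ℝ (γ ^ (n : ℕ)) ∘ₗ evalNegOne (seriesF R γ)) :=
    hom_ext fun w => by simp [evalNegOne_seriesF_append]
  exact LinearMap.congr_fun this x

/-- The three terms of the Rota-Baxter identity match the three terms of the quasi-shuffle
recursion. Weight `-1` together with the sign from `t = -1` gives the contracted term the right
sign. -/
theorem evalNegOne_seriesF_wordMul {R : A →ₗ[ℝ] A} (hR : IsRotaBaxter (-1) R) (γ : A)
    (u v : List ℕ+) :
    evalNegOne (seriesF R γ) (wordMul u v)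
      = evalNegOne (seriesF R γ) (word u) * evalNegOne (seriesF R γ) (word v) := by
  rcases List.eq_nil_or_concat' u with rfl | ⟨u, a, rfl⟩
  · rw [wordMul_nil_left, evalNegOne_seriesF_nil, one_mul]
  rcases List.eq_nil_or_concat' v with rfl | ⟨v, b, rfl⟩
  · rw [wordMul_nil_right, evalNegOne_seriesF_nil, mul_one]
  have h1 := evalNegOne_seriesF_wordMul hR γ u (v ++ [b])
  have h2 := evalNegOne_seriesF_wordMul hR γ (u ++ [a]) v
  have h3 := evalNegOne_seriesF_wordMul hR γ u v
  rw [qsh_wordMul_snoc_snoc, map_add, map_add, evalNegOne_seriesF_snoc, evalNegOne_seriesF_snoc,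
    evalNegOne_seriesF_snoc, h1, h2, h3, evalNegOne_seriesF_append, evalNegOne_seriesF_append,
    neg_mul_neg, hR, ← neg_add, ← neg_add, ← map_add, ← map_add, ← map_neg]
  congr 1
  rw [neg_smul, one_smul, PNat.add_coe, pow_add]
  ring
termination_by u.length + v.length
decreasing_by
  all_goals
    subst_vars
    simp only [List.length_append, List.length_singleton]
    omega

theorem evalNegOne_seriesF_mul {R : A →ₗ[ℝ] A} (hR : IsRotaBaxter (-1) R) (γ : A) (x y : Hqsh) :
    evalNegOne (seriesF R γ) (x * y)
      = evalNegOne (seriesF R γ) x * evalNegOne (seriesF R γ) y :=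
  algHom_mul_of_word _ (evalNegOne_seriesF_wordMul hR γ) x y

end Atkinson

/-! ## Homogeneity of the Atkinson recursion -/

theorem weight_additive (a b c : ℕ+) (h : Contraction.br a b = some c) :
    (c : ℕ) = a + b := by
  cases h
  exact PNat.add_coe a b

theorem arb_mem_graded (f : PlanarForest) :
    f.arb ∈ graded (fun n : ℕ+ => (n : ℕ)) f.weight := by
  induction f with
  | nil => exact one_mem_graded _
  | node a s r hs hr =>
    exact mul_mem_graded weight_additive (prepend_mem_graded a hs) hr

theorem arborification_mem_graded (f : Forest) :
    arborification (Hck.forest f) ∈ graded (fun n : ℕ+ => (n : ℕ)) f.weight := by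
  rw [arborification_forest]
  induction f using Quotient.inductionOn with
  | h f => exact arb_mem_graded f

namespace Shuffle

variable {η : List Letter}

theorem mapa_mem_graded (hη : η.length = 2) (w : List ℕ+) :
    mapa (γ η) (word w) ∈ graded (fun _ => 1) (2 * wt (fun n : ℕ+ => (n : ℕ)) w) := by
  match w with
  | [] => rw [mapa_nil]; exact Submodule.zero_mem _
  | [n] =>
    rw [mapa_of_ne_nil _ (by simp), mapI_singleton]
    simpa using γ_pow_mem_graded hη n
  | m :: n :: w =>
    rw [mapa_of_ne_nil _ (by simp), mapI_cons_cons]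
    exact Submodule.zero_mem _

theorem conv_mem_graded {f g : Conv Hsh}
    (hf : ∀ w, f (word w) ∈ graded (fun _ => 1) (2 * wt (fun n : ℕ+ => (n : ℕ)) w))
    (hg : ∀ w, g (word w) ∈ graded (fun _ => 1) (2 * wt (fun n : ℕ+ => (n : ℕ)) w))
    (w : List ℕ+) :
    (f * g) (word w) ∈ graded (fun _ => 1) (2 * wt (fun n : ℕ+ => (n : ℕ)) w) := by
  rw [conv_word]
  refine Submodule.sum_mem _ fun i _ => ?_
  have := mul_mem_graded length_additive (hf (w.take i)) (hg (w.drop i))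
  rwa [← mul_add, ← wt_append, List.take_append_drop] at this

theorem one_word_mem_graded (w : List ℕ+) :
    (1 : Conv Hsh) (word w) ∈ graded (fun _ => 1) (2 * wt (fun n : ℕ+ => (n : ℕ)) w) := by
  by_cases hw : w = []
  · rw [hw, conv_one_nil]
    exact one_mem_graded _
  · rw [conv_one_of_ne_nil hw]
    exact Submodule.zero_mem _

theorem iterR'_mem_graded (hη : η.length = 2) (n : ℕ) (w : List ℕ+) :
    iterR' R (mapa (γ η)) n (word w)
      ∈ graded (fun _ => 1) (2 * wt (fun n : ℕ+ => (n : ℕ)) w) := by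
  induction n generalizing w with
  | zero => exact one_word_mem_graded w
  | succ n ih => exact R_mem_graded (conv_mem_graded (mapa_mem_graded hη) ih w)

theorem iterR_mem_graded (hη : η.length = 2) (n : ℕ) (w : List ℕ+) :
    iterR R (mapa (γ η)) n (word w)
      ∈ graded (fun _ => 1) (2 * wt (fun n : ℕ+ => (n : ℕ)) w) := by
  induction n generalizing w with
  | zero => exact one_word_mem_graded w
  | succ n ih => exact R_mem_graded (conv_mem_graded ih (mapa_mem_graded hη) w)

theorem evalNegOne_seriesF_mem_graded (hη : η.length = 2) (w : List ℕ+) :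
    evalNegOne (seriesF R (γ η)) (word w)
      ∈ graded (fun _ => 1) (2 * wt (fun n : ℕ+ => (n : ℕ)) w) := by
  rw [evalNegOne_seriesF_word]
  exact Submodule.sum_mem _ fun k _ => Submodule.smul_mem _ _ (iterR_mem_graded hη k w)

theorem evalNegOne_seriesH_mem_graded (hη : η.length = 2) (w : List ℕ+) :
    evalNegOne (seriesH R (γ η)) (word w)
      ∈ graded (fun _ => 1) (2 * wt (fun n : ℕ+ => (n : ℕ)) w) := by
  rw [evalNegOne_seriesH_word]
  exact Submodule.sum_mem _ fun k _ => Submodule.smul_mem _ _ (iterR'_mem_graded hη k w)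

theorem R_one_word (w : List ℕ+) :
    R ((1 : Conv Hsh) (word w)) = (1 : Conv Hsh) (word w) := by
  by_cases hw : w = []
  · rw [hw, conv_one_nil, R_one_eq]
  · rw [conv_one_of_ne_nil hw, map_zero]

theorem R_iterR' (a : Conv Hsh) (n : ℕ) (w : List ℕ+) :
    R (iterR' R a n (word w)) = iterR' R a n (word w) := by
  cases n with
  | zero => exact R_one_word w
  | succ n => exact R_R _

theorem R_evalNegOne_seriesH (w : List ℕ+) :
    R (evalNegOne (seriesH R (γ η)) (word w)) = evalNegOne (seriesH R (γ η)) (word w) := by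
  rw [evalNegOne_seriesH_word, map_sum]
  exact Finset.sum_congr rfl fun k _ => by rw [map_smul, R_iterR']

theorem R_evalNegOne_seriesF (w : List ℕ+) :
    R (evalNegOne (seriesF R (γ η)) (word w)) = evalNegOne (seriesF R (γ η)) (word w) := by
  rcases List.eq_nil_or_concat' w with rfl | ⟨w, n, rfl⟩
  · rw [evalNegOne_seriesF_nil, R_one_eq]
  · rw [evalNegOne_seriesF_append, map_neg, R_R]

/-- Arborified forests mix words of several lengths but a single weight. As `γ` has length `2`, a
map sending weight `n` to length `2n` takes homogeneous values on them. -/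
theorem mem_B_of_word {f : Hqsh →ₗ[ℝ] Hsh} (hR : ∀ w, R (f (word w)) = f (word w))
    (hf : ∀ w, f (word w) ∈ graded (fun _ => 1) (2 * wt (fun n : ℕ+ => (n : ℕ)) w))
    {n : ℕ} {x : Hqsh} (hx : x ∈ graded (fun n : ℕ+ => (n : ℕ)) n) : f x ∈ B := by
  refine ⟨⟨f x, ?_⟩, isHomogeneous_iff.2 ⟨2 * n, ?_⟩⟩
  · have : R ∘ₗ f = f := hom_ext hR
    exact LinearMap.congr_fun this x
  · exact map_mem_of_mem_graded f _ (fun w hw => hw ▸ hf w) hx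

/-! ## The well-behaved Rota-Baxter algebra -/

theorem R_eq_zero_of_mem_range {b : Hsh} (hb : b ∈ Set.range (fun x => x - R x)) : R b = 0 := by
  obtain ⟨x, rfl⟩ := hb
  simp

theorem R_eq_of_mem_range {b : Hsh} (hb : b ∈ Set.range R) : R b = b := by
  obtain ⟨x, rfl⟩ := hb
  exact R_R x

theorem σ_compl_of_R_eq_zero {b : Hsh} (hb : R b = 0) : R (σ b) = σ b := by
  have h := σ_compl b (by rw [← ε_R, hb, map_zero])
  rw [hb, sub_zero] at h
  exact h.symm

theorem isAverageAlgebra (hη : η.length = 2) : IsAverageAlgebra ε R σ σ Θ (γ η) where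
  ε_one := ε_nil
  ε_mul := ε_mul
  ε_γ := ε_eq_zero_of_mem_graded (by omega) (γ_mem_graded η)
  ε_compl x := by rw [map_sub, ε_R, sub_self]
  rotaBaxter := rotaBaxter_R
  idempotent := R_R
  σ_mul b _ n := by rw [σ_mul, σ_γ_pow]
  Θ_one := Θ_one
  Θ_mul := Θ_mul
  Θ_γ := Θ_γ hη
  compat x hx := by rw [σ_compl x hx, sub_self]; exact Submodule.zero_mem _
  σ_γ := σ_γ η
  vanish b hb n := by
    rw [σ_compl_of_R_eq_zero (R_eq_zero_of_mem_range hb), sub_self, mul_zero, map_zero]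

theorem isWellBehaved (hη : η.length = 2) : IsWellBehaved ε R σ σ Θ (γ η) id B where
  toIsAverageAlgebra := isAverageAlgebra hη
  v_one := rfl
  v_mul _ _ := rfl
  subset_range _ hb := hb.1
  iter_mem n f :=
    mem_B_of_word (R_iterR' _ n) (iterR'_mem_graded hη n) (arborification_mem_graded f)
  sum_mem f :=
    mem_B_of_word R_evalNegOne_seriesH (evalNegOne_seriesH_mem_graded hη)
      (arborification_mem_graded f)
  growth := by
    refine ⟨1, one_pos, fun m b hb => ⟨le_rfl, ?_⟩⟩
    obtain ⟨l, hl⟩ := isHomogeneous_iff.1 hb.2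
    rw [one_pow, one_mul]
    exact norm_Θ_R_γ_pow_mul_le hη m hl (R_eq_of_mem_range hb.1)

end Shuffle

/-! ## The algebraic problem of averages -/

namespace Shuffle

variable {η : List Letter}

/-- The Atkinson solution `F` at `t = -1`, in the convolution algebra. -/
def convF (η : List Letter) : Conv Hsh := WithConv.toConv (evalNegOne (seriesF R (γ η)))

/-- The map `σ ∘ F ∘ rev`. -/
def convY (η : List Letter) : Conv Hsh :=
  WithConv.toConv (σ ∘ₗ evalNegOne (seriesF R (γ η)) ∘ₗ rev)

theorem rev_word {Ω : Type} [Contraction Ω] (w : List Ω) :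
    rev (word w) = word w.reverse := extend_word _ _

theorem convY_nil : convY η (word []) = 1 := by
  change σ (evalNegOne (seriesF R (γ η)) (rev (word []))) = 1
  rw [rev_word, List.reverse_nil, evalNegOne_seriesF_nil, σ_one]

/-- Reversal turns the last-letter recursion of `F` into a first-letter one, and `σ` turns `R` into
`id - R`. The argument of `R` has zero augmentation because `γⁿ` has positive degree. -/
theorem convY_cons (hη : η.length = 2) (n : ℕ+) (w : List ℕ+) :
    convY η (word (n :: w))
      = R (γ η ^ (n : ℕ) * convY η (word w)) - γ η ^ (n : ℕ) * convY η (word w) := by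
  change σ (evalNegOne (seriesF R (γ η)) (rev (word (n :: w))))
    = R (γ η ^ (n : ℕ) * σ (evalNegOne (seriesF R (γ η)) (rev (word w))))
      - γ η ^ (n : ℕ) * σ (evalNegOne (seriesF R (γ η)) (rev (word w)))
  rw [rev_word, rev_word, List.reverse_cons, evalNegOne_seriesF_append, map_neg, σ_R, σ_mul,
    σ_γ_pow, mul_comm, neg_sub]
  rw [ε_mul, ε_eq_zero_of_mem_graded _ (γ_pow_mem_graded hη n), mul_zero]
  exact mul_ne_zero two_ne_zero n.ne_zero

theorem R_convY (hη : η.length = 2) {w : List ℕ+} (hw : w ≠ []) :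
    R (convY η (word w)) = 0 := by
  obtain ⟨n, w, rfl⟩ := List.exists_cons_of_ne_nil hw
  rw [convY_cons hη, map_sub, R_R, sub_self]

theorem R_mapI_mul_convY (hη : η.length = 2) (w : List ℕ+) :
    R ((mapI (γ η) * convY η) (word w)) = (mapI (γ η) * convY η) (word w) := by
  cases w with
  | nil => rw [conv_nil, mapI_nil, convY_nil, mul_one, R_one_eq]
  | cons n w => rw [conv_mapI_cons, convY_cons hη, sub_add_cancel, R_R]

theorem R_convF_mul_mapI {w : List ℕ+} (hw : w ≠ []) :
    R ((convF η * mapI (γ η)) (word w)) = 0 := by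
  rcases List.eq_nil_or_concat' w with rfl | ⟨w, n, rfl⟩
  · exact absurd rfl hw
  · rw [conv_mapI_append]
    change R (evalNegOne (seriesF R (γ η)) (word (w ++ [n])) + _) = 0
    rw [evalNegOne_seriesF_append, map_add, map_neg, R_R]
    exact neg_add_cancel _

/-- A Birkhoff-type argument: one bracketing of the triple product lies in `Im R`, the other in `Ker
R`. -/
theorem convF_mul_mapI_mul_convY (hη : η.length = 2) :
    convF η * (mapI (γ η) * convY η) = 1 := by
  have hF : convF η (word []) = 1 := evalNegOne_seriesF_nil R (γ η)
  refine conv_ext fun w => ?_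
  by_cases hw : w = []
  · rw [hw, conv_nil, conv_nil, hF, mapI_nil, convY_nil, conv_one_nil, mul_one, mul_one]
  rw [conv_one_of_ne_nil hw]
  have h1 : R ((convF η * (mapI (γ η) * convY η)) (word w))
      = (convF η * (mapI (γ η) * convY η)) (word w) := by
    rw [conv_word, map_sum]
    exact Finset.sum_congr rfl fun i _ =>
      R_mul_of_R_eq (R_evalNegOne_seriesF _) (R_mapI_mul_convY hη _)
  rw [← h1, ← mul_assoc, conv_word, map_sum]
  refine Finset.sum_eq_zero fun i _ => ?_
  -- Only one of the two factors can be the empty-word value `1`, since `w` is nonempty; so every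
  -- term remains in `Ker R`.
  by_cases hu : w.take i = []
  · rw [hu, conv_nil, hF, mapI_nil, one_mul, one_mul]
    refine R_convY hη fun hv => hw ?_
    rw [← List.take_append_drop i w, hu, hv, List.nil_append]
  · by_cases hv : w.drop i = []
    · rw [hv, convY_nil, mul_one]
      exact R_convF_mul_mapI hu
    · exact R_mul_of_R_eq_zero (R_convF_mul_mapI hu) (R_convY hη hv)

/-- The character `Θ ∘ F` at `t = -1`. -/
def φ (η : List Letter) : Hqsh →ₐ[ℝ] ℂ :=
  AlgHom.ofLinearMap (Θ ∘ₗ evalNegOne (seriesF R (γ η)))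
    (by rw [one_def, LinearMap.comp_apply, evalNegOne_seriesF_nil, Θ_one])
    (fun x y => by
      rw [LinearMap.comp_apply, evalNegOne_seriesF_mul rotaBaxter_R, Θ_mul]
      rfl)

theorem φ_apply (x : Hqsh) : φ η x = Θ (evalNegOne (seriesF R (γ η)) x) := rfl

theorem conj_Θ (x : Hsh) : Complex.conjAe (Θ x) = Θ x := by
  have : Complex.conjAe.toLinearMap ∘ₗ Θ = Θ := hom_ext fun w => by
    simp [Θ_word]
  exact LinearMap.congr_fun this x

theorem Θ_comp_mapI (hη : η.length = 2) :
    (WithConv.toConv (ΘHom.toLinearMap ∘ₗ (mapI (γ η)).ofConv) : Conv ℂ) = iota := by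
  refine conv_ext fun w => ?_
  change Θ (mapI (γ η) (word w))
    = extend (fun w : List ℕ+ => if w.length ≤ 1 then (1 : ℂ) else 0) (word w)
  rw [extend_word]
  match w with
  | [] => simp [mapI_nil, Θ_one]
  | [n] => simp [mapI_singleton, Θ_γ_pow hη]
  | m :: n :: w => simp [mapI_cons_cons]

theorem solvesAlgebraicProblem (hη : η.length = 2) : SolvesAlgebraicProblem (φ η) := by
  have key := congrArg WithConv.toConv
    (congrArg (ΘHom.toLinearMap ∘ₗ ·) (congrArg WithConv.ofConv (convF_mul_mapI_mul_convY hη)))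
  simp only [LinearMap.algHom_comp_convMul_distrib, WithConv.toConv_ofConv, Θ_comp_mapI hη] at key
  have hone : WithConv.toConv (ΘHom.toLinearMap ∘ₗ (1 : Conv Hsh).ofConv) = (1 : Conv ℂ) := by
    refine conv_ext fun w => ?_
    change ΘHom ((1 : Conv Hsh) (word w)) = _
    by_cases hw : w = []
    · rw [hw, conv_one_nil, conv_one_nil, map_one]
    · rw [conv_one_of_ne_nil hw, conv_one_of_ne_nil hw, map_zero]
  have hY : WithConv.toConv (ΘHom.toLinearMap ∘ₗ (convY η).ofConv)
      = (WithConv.toConv (Complex.conjAe.toLinearMap ∘ₗ (φ η).toLinearMap ∘ₗ rev) : Conv ℂ) := by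
    refine conv_ext fun w => ?_
    change Θ (σ (evalNegOne (seriesF R (γ η)) (rev (word w))))
      = Complex.conjAe (Θ (evalNegOne (seriesF R (γ η)) (rev (word w))))
    rw [Θ_σ, conj_Θ]
  have hF : WithConv.toConv (ΘHom.toLinearMap ∘ₗ (convF η).ofConv)
      = (WithConv.toConv (φ η).toLinearMap : Conv ℂ) := rfl
  rw [hone, hY, hF] at key
  obtain ⟨u, hu⟩ := exists_conv_unit (WithConv.toConv (φ η).toLinearMap : Conv ℂ)
    (map_one (φ η))
  obtain ⟨y, hy⟩ := exists_conv_unit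
    (WithConv.toConv (Complex.conjAe.toLinearMap ∘ₗ (φ η).toLinearMap ∘ₗ rev) : Conv ℂ) (by
      change Complex.conjAe (φ η (rev (word []))) = 1
      rw [rev_word, List.reverse_nil, ← one_def, map_one, map_one])
  refine ⟨u, y⁻¹, hu, by rw [inv_inv, hy], ?_⟩
  rw [← hu, ← hy] at key
  rw [Units.val_mul, Units.inv_mul_eq_iff_eq_mul]
  exact Units.inv_eq_of_mul_eq_one_left ((mul_assoc _ _ _).trans key)

end Shuffle

open Polynomial

/-! ## Polynomial lift of the character and geometrical growth -/

/-- The linear map on polynomials with given values on the powers of `X`. -/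
def powExtend {M : Type} [AddCommGroup M] [Module ℝ M] (f : ℕ → M) : ℝ[X] →ₗ[ℝ] M :=
  (Polynomial.basisMonomials ℝ).constr ℝ f

theorem powExtend_X_pow {M : Type} [AddCommGroup M] [Module ℝ M] (f : ℕ → M) (k : ℕ) :
    powExtend f (X ^ k) = f k := by
  have := (Polynomial.basisMonomials ℝ).constr_basis ℝ f k
  rw [Polynomial.coe_basisMonomials] at this
  rw [← Polynomial.monomial_one_right_eq_X_pow]
  exact this

/-- The coefficient of the constant term in `tailOp`. -/
def tailCoeff (a : ℕ+) (k : ℕ) : ℝ := a / (2 * (a + k))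

/-- The operator `P ↦ -(xᵃ P(x) + ½ ∫ₓ¹ a yᵃ⁻¹ P(y) dy)` on polynomials. -/
def tailOp (a : ℕ+) : ℝ[X] →ₗ[ℝ] ℝ[X] :=
  powExtend fun k =>
    -(C (tailCoeff a k) + C (1 - tailCoeff a k) * X ^ ((a : ℕ) + k))

theorem tailOp_X_pow (a : ℕ+) (k : ℕ) :
    tailOp a (X ^ k) = -(C (tailCoeff a k) + C (1 - tailCoeff a k) * X ^ ((a : ℕ) + k)) :=
  powExtend_X_pow _ k

theorem polynomial_hom_ext {M : Type} [AddCommGroup M] [Module ℝ M] {f g : ℝ[X] →ₗ[ℝ] M}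
    (h : ∀ k : ℕ, f (X ^ k) = g (X ^ k)) : f = g := by
  refine Polynomial.lhom_ext' fun k => LinearMap.ext_ring ?_
  simpa [Polynomial.monomial_one_right_eq_X_pow] using h k

/-- This is the quasi-shuffle recursion at the level of operators, which makes `polyLift`
multiplicative. By bilinearity it reduces to monomials. -/
theorem tailOp_mul_tailOp (a b : ℕ+) (P Q : ℝ[X]) :
    tailOp a P * tailOp b Q
      = tailOp a (P * tailOp b Q) + tailOp b (tailOp a P * Q) + tailOp (a + b) (P * Q) := by
  have h : (LinearMap.mul ℝ ℝ[X]).compl₁₂ (tailOp a) (tailOp b)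
      = ((LinearMap.mul ℝ ℝ[X]).compl₁₂ LinearMap.id (tailOp b)).compr₂ (tailOp a)
        + ((LinearMap.mul ℝ ℝ[X]).compl₁₂ (tailOp a) LinearMap.id).compr₂ (tailOp b)
        + (LinearMap.mul ℝ ℝ[X]).compr₂ (tailOp (a + b)) := by
    refine polynomial_hom_ext fun i => polynomial_hom_ext fun j => ?_
    simp only [LinearMap.compl₁₂_apply, LinearMap.compr₂_apply, LinearMap.add_apply,
      LinearMap.id_apply, LinearMap.mul_apply']
    have e1 : (X ^ i * tailOp b (X ^ j) : ℝ[X])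
        = -(tailCoeff b j • X ^ i + (1 - tailCoeff b j) • X ^ (i + (b + j))) := by
      rw [tailOp_X_pow, smul_eq_C_mul, smul_eq_C_mul]
      ring
    have e2 : (tailOp a (X ^ i) * X ^ j : ℝ[X])
        = -(tailCoeff a i • X ^ j + (1 - tailCoeff a i) • X ^ ((a + i) + j)) := by
      rw [tailOp_X_pow, smul_eq_C_mul, smul_eq_C_mul]
      ring
    rw [e1, e2, ← pow_add]
    simp only [map_neg, map_add, map_smul]
    simp only [tailOp_X_pow, smul_eq_C_mul, PNat.add_coe]
    have ha : (0 : ℝ) < a := by exact_mod_cast a.pos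
    have hb : (0 : ℝ) < b := by exact_mod_cast b.pos
    have c3 : tailCoeff (a + b) (i + j)
        = tailCoeff a (i + (b + j)) + tailCoeff b (a + i + j) := by
      unfold tailCoeff; push_cast; field_simp; ring
    -- The partial fraction `1/(pq) = (1/p + 1/q)/(p+q)` with `p = a + i`, `q = b + j`.
    have c4 : tailCoeff a (i + (b + j)) * tailCoeff b j
        + tailCoeff b (a + i + j) * tailCoeff a i = tailCoeff a i * tailCoeff b j := by
      unfold tailCoeff; push_cast; field_simp; ring
    have c4' := congrArg (C : ℝ → ℝ[X]) c4
    simp only [c3, map_sub, map_add, map_mul, map_one] at c4' ⊢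
    linear_combination (1 - X ^ ((a : ℕ) + i + (b + j))) * c4'
  have := LinearMap.congr_fun₂ h P Q
  simpa using this

/-- The lift of words to polynomials: `Φ(∅) = 1`, `Φ(a w) = tailOp a (Φ w)`. -/
def polyLiftFun : List ℕ+ → ℝ[X]
  | [] => 1
  | a :: w => tailOp a (polyLiftFun w)

/-- The linear extension of `polyLiftFun`. -/
def polyLift : Hqsh →ₗ[ℝ] ℝ[X] := extend polyLiftFun

theorem polyLift_nil : polyLift (word []) = 1 := extend_word _ _

theorem polyLift_cons (a : ℕ+) (w : List ℕ+) :
    polyLift (word (a :: w)) = tailOp a (polyLift (word w)) := by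
  rw [polyLift, extend_word, extend_word, polyLiftFun]

theorem polyLift_prepend (a : ℕ+) (x : Hqsh) :
    polyLift (prepend a x) = tailOp a (polyLift x) := by
  have : polyLift ∘ₗ prepend a = tailOp a ∘ₗ polyLift := hom_ext fun w => by
    simp [polyLift_cons]
  exact LinearMap.congr_fun this x

theorem polyLift_wordMul (u v : List ℕ+) :
    polyLift (wordMul u v) = polyLift (word u) * polyLift (word v) := by
  match u, v with
  | [], v => rw [wordMul_nil_left, polyLift_nil, one_mul]
  | a :: u, [] => rw [wordMul_nil_right, polyLift_nil, mul_one]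
  | a :: u, b :: v =>
    rw [qsh_wordMul_cons_cons, map_add, map_add, polyLift_prepend, polyLift_prepend,
      polyLift_prepend, polyLift_wordMul u (b :: v), polyLift_wordMul (a :: u) v,
      polyLift_wordMul u v, polyLift_cons, polyLift_cons, tailOp_mul_tailOp]
termination_by u.length + v.length

theorem polyLift_mul (x y : Hqsh) : polyLift (x * y) = polyLift x * polyLift y :=
  algHom_mul_of_word _ polyLift_wordMul x y

/-! ### The polynomial lift of a forest is bounded by `1` on the unit interval -/

/-- The primitive, vanishing at `0`, of `a xᵃ⁻¹ P(x)`. -/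
def weightedPrimitive (a : ℕ+) : ℝ[X] →ₗ[ℝ] ℝ[X] :=
  powExtend fun k => C (2 * tailCoeff a k) * X ^ ((a : ℕ) + k)

theorem weightedPrimitive_X_pow (a : ℕ+) (k : ℕ) :
    weightedPrimitive a (X ^ k) = C (2 * tailCoeff a k) * X ^ ((a : ℕ) + k) :=
  powExtend_X_pow _ k

theorem derivative_weightedPrimitive (a : ℕ+) (P : ℝ[X]) :
    derivative (weightedPrimitive a P) = C (a : ℝ) * X ^ ((a : ℕ) - 1) * P := by
  have : derivative ∘ₗ weightedPrimitive a
      = LinearMap.mulLeft ℝ (C (a : ℝ) * X ^ ((a : ℕ) - 1)) := by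
    refine polynomial_hom_ext fun k => ?_
    have ha : (0 : ℝ) < a := by exact_mod_cast a.pos
    have hc : 2 * tailCoeff a k * ((a + k : ℕ) : ℝ) = a := by
      unfold tailCoeff; push_cast; field_simp
    rw [LinearMap.comp_apply, weightedPrimitive_X_pow, LinearMap.mulLeft_apply,
      derivative_C_mul_X_pow, hc, mul_assoc, ← pow_add,
      Nat.sub_add_comm (Nat.one_le_iff_ne_zero.2 a.ne_zero)]
  exact LinearMap.congr_fun this P

theorem tailOp_eq (a : ℕ+) (P : ℝ[X]) :
    tailOp a P = -(X ^ (a : ℕ) * P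
      + C (1 / 2) * (C ((weightedPrimitive a P).eval 1) - weightedPrimitive a P)) := by
  have : tailOp a = -(LinearMap.mulLeft ℝ (X ^ (a : ℕ)) + (1 / 2 : ℝ) •
      (Polynomial.CAlgHom.toLinearMap ∘ₗ Polynomial.leval 1 ∘ₗ weightedPrimitive a
        - weightedPrimitive a)) := by
    refine polynomial_hom_ext fun k => ?_
    simp only [LinearMap.neg_apply, LinearMap.add_apply, LinearMap.smul_apply,
      LinearMap.sub_apply, LinearMap.comp_apply, weightedPrimitive_X_pow, tailOp_X_pow,
      LinearMap.mulLeft_apply, Polynomial.leval_apply, smul_eq_C_mul]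
    have e : (C (1 / 2 : ℝ) : ℝ[X]) * C (2 * tailCoeff a k) = C (tailCoeff a k) := by
      rw [← C_mul]; congr 1; ring
    simp only [eval_mul, eval_C, eval_pow, eval_X, one_pow, mul_one, map_sub, map_one,
      AlgHom.toLinearMap_apply, CAlgHom_apply]
    rw [mul_sub, ← mul_assoc, e, pow_add]
    ring
  have := LinearMap.congr_fun this P
  simpa [smul_eq_C_mul] using this

/-- The integral is at most `∫ₓ¹ a yᵃ⁻¹ dy = 1 - xᵃ` in absolute value, so the total is at most `xᵃ
+ ½(1 - xᵃ) ≤ 1`. -/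
theorem abs_eval_tailOp_le (a : ℕ+) (P : ℝ[X])
    (hP : ∀ x ∈ Set.Icc (0 : ℝ) 1, |P.eval x| ≤ 1) :
    ∀ x ∈ Set.Icc (0 : ℝ) 1, |(tailOp a P).eval x| ≤ 1 := by
  -- The integral bound without integrals: `xᵃ - s W`, with `W` the weighted primitive, has
  -- derivative `a xᵃ⁻¹(1 - s P) ≥ 0`. Taking `s = ±1` bounds both signs.
  have mono (s : ℝ) (hs : |s| ≤ 1) (x : ℝ) (hx : x ∈ Set.Icc (0 : ℝ) 1) :
      s * (weightedPrimitive a P).eval 1 - s * (weightedPrimitive a P).eval x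
        ≤ 1 - x ^ (a : ℕ) := by
    have hm : MonotoneOn (fun y => (X ^ (a : ℕ) - C s * weightedPrimitive a P).eval y)
        (Set.Icc 0 1) := by
      refine monotoneOn_of_deriv_nonneg (convex_Icc 0 1) (Polynomial.continuous _).continuousOn
        (Polynomial.differentiable _).differentiableOn fun y hy => ?_
      rw [interior_Icc] at hy
      have hPy := hP y ⟨hy.1.le, hy.2.le⟩
      have h1 : s * P.eval y ≤ 1 := by
        refine (le_abs_self _).trans ?_
        rw [abs_mul]
        exact mul_le_one₀ hs (abs_nonneg _) hPy
      rw [Polynomial.deriv, derivative_sub, derivative_C_mul, derivative_weightedPrimitive,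
        derivative_X_pow]
      simp only [eval_sub, eval_mul, eval_C, eval_pow, eval_X]
      have h2 : 0 ≤ (a : ℝ) * y ^ ((a : ℕ) - 1) := by
        have := hy.1.le
        positivity
      nlinarith
    have := hm hx (Set.right_mem_Icc.2 zero_le_one) hx.2
    simp only [eval_sub, eval_mul, eval_C, eval_pow, eval_X, one_pow] at this
    linarith
  intro x hx
  have h1 := mono 1 (by norm_num) x hx
  have h2 := mono (-1) (by norm_num) x hx
  have hx0 : 0 ≤ x ^ (a : ℕ) := pow_nonneg hx.1 _
  have hx1 : x ^ (a : ℕ) ≤ 1 := pow_le_one₀ hx.1 hx.2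
  have h3 := abs_le.1 (hP x hx)
  rw [tailOp_eq]
  simp only [eval_neg, eval_add, eval_sub, eval_mul, eval_C, eval_pow, eval_X]
  rw [abs_neg, abs_le]
  constructor
  · nlinarith [mul_nonneg hx0 (by linarith [h3.1] : 0 ≤ P.eval x + 1)]
  · nlinarith [mul_nonneg hx0 (by linarith [h3.2] : 0 ≤ 1 - P.eval x)]

theorem abs_eval_polyLift_arb_le (f : PlanarForest) :
    ∀ x ∈ Set.Icc (0 : ℝ) 1, |(polyLift f.arb).eval x| ≤ 1 := by
  induction f with
  | nil =>
    intro x _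
    rw [PlanarForest.arb, one_def, polyLift_nil]
    simp
  | node a s r hs hr =>
    intro x hx
    rw [PlanarForest.arb, polyLift_mul, polyLift_prepend, eval_mul, abs_mul]
    exact mul_le_one₀ (abs_eval_tailOp_le a _ hs x hx) (abs_nonneg _) (hr x hx)

/-! ### The explicit form of the character -/

/-- The explicit weights of words, started at `s`. -/
def pathWeight : ℕ → List ℕ+ → ℝ
  | _, [] => 1
  | s, a :: w => -((2 * s + a) / (2 * (s + a))) * pathWeight (s + a) w

theorem pathWeight_append (s : ℕ) (w : List ℕ+) (n : ℕ+) :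
    pathWeight s (w ++ [n])
      = -((2 * (s + wt (fun n : ℕ+ => (n : ℕ)) w) + n)
          / (2 * (s + wt (fun n : ℕ+ => (n : ℕ)) w + n))) * pathWeight s w := by
  induction w generalizing s with
  | nil => simp [pathWeight]
  | cons a w ih =>
    rw [List.cons_append, pathWeight, pathWeight, ih, wt_cons]
    push_cast
    rw [add_assoc (s : ℝ)]
    ring

/-- The moments `Xᵏ ↦ s / (s + k)` of the density `s xˢ⁻¹` on the unit interval (the value at `0`
if `s = 0`). -/
def moment (s : ℕ) : ℝ[X] →ₗ[ℝ] ℝ :=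
  powExtend fun k => if k = 0 then 1 else (s / (s + k) : ℝ)

theorem moment_X_pow (s k : ℕ) :
    moment s (X ^ k) = if k = 0 then 1 else (s / (s + k) : ℝ) :=
  powExtend_X_pow _ k

/-- For `s > 0`, exchanging the order of integration gives `-(s + a/2) ∫₀¹ xˢ⁺ᵃ⁻¹ P dx`; normalising
the density produces the factor. At `s = 0` the moment is evaluation at `0`. -/
theorem moment_tailOp (s : ℕ) (a : ℕ+) (P : ℝ[X]) :
    moment s (tailOp a P) = -((2 * s + a) / (2 * (s + a))) * moment (s + a) P := by
  have : moment s ∘ₗ tailOp a = (-((2 * s + a) / (2 * (s + a))) : ℝ) • moment (s + a) := by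
    refine polynomial_hom_ext fun k => ?_
    have ha : (0 : ℝ) < a := by exact_mod_cast a.pos
    have h1 : (C (tailCoeff a k) : ℝ[X]) = tailCoeff a k • X ^ 0 := by
      rw [smul_eq_C_mul, pow_zero, mul_one]
    rw [LinearMap.comp_apply, tailOp_X_pow, ← smul_eq_C_mul, h1, map_neg, map_add, map_smul,
      map_smul, moment_X_pow, moment_X_pow, LinearMap.smul_apply, moment_X_pow, if_pos rfl,
      if_neg (by have := a.pos; omega)]
    unfold tailCoeff
    simp only [smul_eq_mul]
    push_cast
    split_ifs with hk
    · subst hk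
      push_cast
      field_simp
      ring
    · field_simp
      ring
  exact LinearMap.congr_fun this P

theorem moment_polyLift (s : ℕ) (w : List ℕ+) : moment s (polyLift (word w)) = pathWeight s w := by
  induction w generalizing s with
  | nil =>
    rw [polyLift_nil, pathWeight, ← pow_zero (X : ℝ[X]), moment_X_pow, if_pos rfl]
  | cons a w ih => rw [polyLift_cons, moment_tailOp, ih, pathWeight]

theorem moment_zero (P : ℝ[X]) : moment 0 P = P.eval 0 := by
  have : moment 0 = Polynomial.leval 0 := by
    refine polynomial_hom_ext fun k => ?_
    rw [moment_X_pow, Polynomial.leval_apply, eval_pow, eval_X, zero_pow_eq]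
    simp
  exact LinearMap.congr_fun this P

namespace Shuffle

variable {η : List Letter}

theorem φ_word (hη : η.length = 2) (w : List ℕ+) : φ η (word w) = (pathWeight 0 w : ℂ) := by
  induction w using List.reverseRecOn with
  | nil => rw [← one_def, map_one, pathWeight, Complex.ofReal_one]
  | append_singleton w n ih =>
    have hn : (n : ℂ) ≠ 0 := by exact_mod_cast n.ne_zero
    have h : (wt (fun n : ℕ+ => (n : ℕ)) w + n : ℂ) ≠ 0 := by
      exact_mod_cast (by have := n.pos; omega : wt (fun n : ℕ+ => (n : ℕ)) w + (n : ℕ) ≠ 0)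
    rw [φ_apply, evalNegOne_seriesF_append, mul_comm, map_neg,
      -- Here `l` is twice the weight of `w`, so `(l + n)/(l + 2n)` becomes the factor of
      -- `pathWeight_append` at `s = 0`.
      Θ_R_γ_pow_mul hη n.ne_zero (evalNegOne_seriesF_mem_graded hη w) (R_evalNegOne_seriesF w),
      ← φ_apply, ih, pathWeight_append]
    push_cast
    rw [zero_add, ← neg_mul, ← mul_add]

theorem φ_eq_eval_polyLift (hη : η.length = 2) (x : Hqsh) :
    φ η x = ((polyLift x).eval 0 : ℝ) := by
  have : (φ η).toLinearMap = Complex.ofRealAm.toLinearMap ∘ₗ Polynomial.leval 0 ∘ₗ polyLift :=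
    hom_ext fun w => by
      simp [φ_word hη, ← moment_polyLift, moment_zero]
  exact LinearMap.congr_fun this x

theorem hasGeometricGrowth (hη : η.length = 2) :
    HasGeometricGrowth ((φ η).comp arborification) := by
  refine ⟨1, 1, one_pos, one_pos, fun f => ?_⟩
  rw [one_pow, mul_one, AlgHom.comp_apply, arborification_forest, φ_eq_eval_polyLift hη,
    Complex.norm_real]
  induction f using Quotient.inductionOn with
  | h f => exact abs_eval_polyLift_arb_le f 0 (Set.left_mem_Icc.2 zero_le_one)

end Shuffle

end

end RBAverages

theorem mainTheorem11 (η : List Letter) (hη : η.length = 2) :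
    IsWellBehaved Shuffle.ε Shuffle.R Shuffle.σ Shuffle.σ Shuffle.Θ (Shuffle.γ η) id Shuffle.B ∧
    (∀ (n : ℕ) (w : List ℕ+), w.length < n →
      (iterR Shuffle.R (mapa (Shuffle.γ η)) n) (WordAlg.word w) = 0) ∧
    ∃ φ : Hqsh →ₐ[ℝ] ℂ,
      φ.toLinearMap = Shuffle.Θ ∘ₗ evalNegOne (seriesF Shuffle.R (Shuffle.γ η)) ∧
      SolvesAlgebraicProblem φ ∧ SolvesAnalyticProblem φ :=
  ⟨Shuffle.isWellBehaved hη, iterR_eq_zero Shuffle.R (Shuffle.γ η), Shuffle.φ η, rfl,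
    Shuffle.solvesAlgebraicProblem hη, Shuffle.solvesAlgebraicProblem hη,
    Shuffle.hasGeometricGrowth hη⟩
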